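/- Let $X\ge 0$ and $\varepsilon$ be independent real random variables with probability densities $f$ and $f_\varepsilon$, let $F$ be the distribution function of $X$, and let $Y_i=X_i+\varepsilon_i$, $i\ge 1$, where $(X_i,\varepsilon_i)_{i\ge1}$ are i.i.d. copies of $(X,\varepsilon)$. For integrable $g$ write $\mathcal Fg(t)=\int e^{its}g(s)\,ds$, and for an integrable $g$ let $\mathcal F^{-1}g(x)=\frac1{2\pi}\int e^{-itx}g(t)\,dt$. Put $\varphi_\varepsilon=\mathcal Ff_\varepsilon$ and $\varphi_n(t)=\frac1n\sum_{i=1}^n e^{itY_i}$. Let $K$ be a real-valued integrable kernel with $\int K=1$, let $h_n>0$ be bandwidths with $h_n\to0$, let $K_{h}(x)=h^{-1}K(x/h)$, and for $x\ge 0$ define $$f_n^d(x)=\mathcal F^{-1}\Big[\mathcal FK_{h_n}\frac{\varphi_n}{\varphi_\varepsilon}\Big](x),\qquad F_n^d(x)=\int_0^x f_n^d(t)\,dt,\qquad \hat F_n^d(x)=\frac{F_n^d(x)}{\lim_{t\to\infty}F_n^d(t)} .$$ For a bounded function $\theta$ on $[0,\infty)$ let $\mathcal M\theta$ be its least concave majorant,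 $\mathcal M\theta(x)=\inf\{g(x): g \text{ bounded and concave on }[0,\infty),\ g\ge\theta\}$; the slope of $\mathcal M\theta$ is its derivative (the right derivative at $0$). Let $\|\theta\|_\infty=\sup_{x\ge0}|\theta(x)|$. Assume that $\mathcal FK$ vanishes outside $[-1,1]$; that $\varphi_\varepsilon$ has no zeros and, for some $\beta>0$ and $C>0$, $|1/\varphi_\varepsilon(t)|\le C(1+|t|^2)^{\beta/2}$ for all $t\in\mathbb R$; that $h_n^{2+2\beta}n\to\infty$; and that $f$ is bounded, continuous on $[0,\infty)$ and satisfies $\int|\mathcal Ff|<\infty$. Then $\mathcal MF$ is differentiable on $[0,\infty)$ and, with probability tending to one as $n\to\infty$, $F_n^d$ is bounded on $[0,\infty)$, $\lim_{t\to\infty}F_n^d(t)$ exists in $(0,\infty)$, and $\mathcal MF_n^d$ and $\mathcal M\hat F_n^d$ are differentiable on $[0,\infty)$. Moreover, for $\mathcal M_n=\mathcal MF_n^d$ as well as for $\mathcal M_n=\mathcal M\hat F_n^d$, with $f_{n0}$ the slope of $\mathcal M_n$ and $f_0$ the slope of $\mathcal MF$, as $n\to\infty$, $$\|\mathcal M_n-\mathcal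 MF\|_\infty=o_p(1)\qquad\text{and}\qquad \|f_{n0}-f_0\|_\infty=o_p(1).$$ -/

import Mathlib

open MeasureTheory ProbabilityTheory Set Filter Topology
open scoped ENNReal

noncomputable section

namespace Deconv

/-- The Fourier transform with the convention of characteristic functions,
`𝓕 g (t) = ∫ exp (i t s) g (s) ds`, of an integrable function `g`. -/
def fourier (g : ℝ → ℝ) (t : ℝ) : ℂ :=
  ∫ s : ℝ, Complex.exp (Complex.I * t * s) * (g s : ℂ)

/-- The corresponding inverse transform, `(2π)⁻¹ ∫ exp (-i t x) g (t) dt`. -/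
def fourierInv (g : ℝ → ℂ) (x : ℝ) : ℂ :=
  (2 * Real.pi : ℂ)⁻¹ * ∫ t : ℝ, Complex.exp (-(Complex.I * t * x)) * g t

/-- The rescaled kernel `K_h (x) = h⁻¹ K (x / h)`. -/
def scaled (K : ℝ → ℝ) (h : ℝ) (x : ℝ) : ℝ := h⁻¹ * K (x / h)

/-- The empirical characteristic function of the first `n` terms of the sample `y`. -/
def empChar (n : ℕ) (y : ℕ → ℝ) (t : ℝ) : ℂ :=
  (n : ℂ)⁻¹ * ∑ i ∈ Finset.range n, Complex.exp (Complex.I * t * y i)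

/-- The deconvolution density estimator as the complex number
`𝓕⁻¹ [𝓕 K_h · φ_n / 𝓕 fε] (x)`. -/
def densityEstC (K fε : ℝ → ℝ) (h : ℝ) (n : ℕ) (y : ℕ → ℝ) (x : ℝ) : ℂ :=
  fourierInv (fun t => fourier (scaled K h) t * empChar n y t / fourier fε t) x

/-- The deconvolution density estimator as a real number; see `densityEstC_eq_ofReal`: for a real
kernel, `densityEstC` takes real values. -/
def densityEst (K fε : ℝ → ℝ) (h : ℝ) (n : ℕ) (y : ℕ → ℝ) (x : ℝ) : ℝ :=
  (densityEstC K fε h n y x).re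

theorem conj_fourier (g : ℝ → ℝ) (t : ℝ) :
    (starRingEnd ℂ) (fourier g t) = fourier g (-t) := by
  unfold fourier
  rw [← integral_conj]
  congr 1
  ext s
  simp [← Complex.exp_conj]

theorem conj_empChar (n : ℕ) (y : ℕ → ℝ) (t : ℝ) :
    (starRingEnd ℂ) (empChar n y t) = empChar n y (-t) := by
  simp [empChar, ← Complex.exp_conj]

/-- The deconvolution density estimator is real-valued. -/
theorem densityEstC_eq_ofReal (K fε : ℝ → ℝ) (h : ℝ) (n : ℕ) (y : ℕ → ℝ) (x : ℝ) :
    densityEstC K fε h n y x = (densityEst K fε h n y x : ℂ) := by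
  unfold densityEst
  rw [eq_comm, ← Complex.conj_eq_iff_re]
  unfold densityEstC fourierInv
  rw [map_mul, ← integral_conj]
  congr 1
  · simp [Complex.conj_ofNat]
  · rw [← integral_neg_eq_self]
    congr 1
    ext t
    simp [← Complex.exp_conj, conj_fourier, conj_empChar]

/-- The basic estimator of the distribution function, `∫₀ˣ` of the density estimator (`x ≥ 0`). -/
def cdfEst (K fε : ℝ → ℝ) (h : ℝ) (n : ℕ) (y : ℕ → ℝ) (x : ℝ) : ℝ :=
  ∫ t in (0 : ℝ)..x, densityEst K fε h n y t

/-- The normalized estimator: the basic one divided by its limit at `+∞`. -/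
def cdfEstNorm (K fε : ℝ → ℝ) (h : ℝ) (n : ℕ) (y : ℕ → ℝ) (x : ℝ) : ℝ :=
  cdfEst K fε h n y x / limUnder atTop (cdfEst K fε h n y)

/-- `g` is bounded on `I`. -/
def BoundedOn (g : ℝ → ℝ) (I : Set ℝ) : Prop := ∃ M : ℝ, ∀ x ∈ I, |g x| ≤ M

/-- The least concave majorant on `I` of a function `θ` that is bounded on `I`. -/
def lcMajorantOn (I : Set ℝ) (θ : ℝ → ℝ) (x : ℝ) : ℝ :=
  sInf {y : ℝ | ∃ g : ℝ → ℝ,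
    BoundedOn g I ∧ ConcaveOn ℝ I g ∧ (∀ z ∈ I, θ z ≤ g z) ∧ y = g x}

/-- The least concave majorant on `[0, ∞)`. -/
def lcMajorant (θ : ℝ → ℝ) : ℝ → ℝ := lcMajorantOn (Ici 0) θ

/-- The slope on `[0, ∞)`: the derivative at `x > 0`, the right derivative at `x = 0`. -/
def slopeFn (g : ℝ → ℝ) (x : ℝ) : ℝ := derivWithin g (Ici 0) x

/-- The supremum norm on `[0, ∞)`, equal to `∞` for an unbounded function. -/
def supNorm (θ : ℝ → ℝ) : ℝ≥0∞ := ⨆ x ∈ Ici (0 : ℝ), ENNReal.ofReal |θ x|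

variable {Ω : Type*} [MeasurableSpace Ω]

/-- `Z n = o_p(1)`. -/
def LittleOP (μ : Measure Ω) (Z : ℕ → Ω → ℝ≥0∞) : Prop :=
  ∀ δ : ℝ≥0∞, 0 < δ → Tendsto (fun n => μ {ω | δ ≤ Z n ω}) atTop (𝓝 0)

/-- The property `E n` holds with probability tending to one. -/
def ProbTendsToOne (μ : Measure Ω) (E : ℕ → Ω → Prop) : Prop :=
  Tendsto (fun n => μ {ω | ¬ E n ω}) atTop (𝓝 0)

/-- The measurement error model: `X i ≥ 0` are copies of a variable with density `f`, `ε i` are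
copies of a variable with density `fε`, `X i` is independent of `ε i`, and the pairs
`(X i, ε i)` are independent. The observations are `Y i = X i + ε i`. -/
structure Model (μ : Measure Ω) (X ε : ℕ → Ω → ℝ) (f fε : ℝ → ℝ) : Prop where
  measurable_X : ∀ i, Measurable (X i)
  measurable_err : ∀ i, Measurable (ε i)
  measurable_f : Measurable f
  measurable_f_err : Measurable fε
  f_nonneg : ∀ x, 0 ≤ f x
  f_err_nonneg : ∀ x, 0 ≤ fε x
  X_nonneg : ∀ i, ∀ᵐ ω ∂μ, 0 ≤ X i ω
  law_X : ∀ i, μ.map (X i) = volume.withDensity (fun x => ENNReal.ofReal (f x))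
  law_err : ∀ i, μ.map (ε i) = volume.withDensity (fun x => ENNReal.ofReal (fε x))
  indep_X_err : ∀ i, IndepFun (X i) (ε i) μ
  indep_pairs : iIndepFun (fun i ω => (X i ω, ε i ω)) μ

end Deconv

end

/-!
Everything reduces to the uniform convergence, in probability, of the density estimator to `f` and
of its primitive to `F` on `[0, ∞)`, because the least concave majorant is stable: if `θ` is bounded
with a bounded derivative, its majorant is differentiable (a kink could be cut off by a line, or
would contradict the derivative of `θ` at a contact point), the slope is uniformly continuous, and
a bounded function that starts from the same value and is uniformly close to `θ` together with its
derivative has a majorant and a slope uniformly close to those of `θ`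
(`BoundedC1.exists_stability`). Closeness of the derivatives is needed at the origin only, where
closeness of the functions does not control the slope of the majorant.

For the density, the stochastic error is at most the integral of
`|fourier K_h| |φ_n - φ_Y| / |fourier fε|`. Since `E |φ_n - φ_Y| ≤ 2 / √n`, its mean is of order
`h ^ (-β) h⁻¹ / √n`, which the condition on the bandwidths sends to zero (`tendsto_noise`). The
bias tends to zero because `fourier f` is integrable.

For the primitive on the whole half-line, the difficulty is at frequency zero: integration divides
by `t`, and in the absence of moments `(φ_n - φ_Y) / t` need not be integrable there. A local form of
Wiener's lemma (`exists_norm_one_sub_fourier_mul_le`) provides an integrable function `G` with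
`|1 - fourier G * fourier fε| ≤ c |t|`. Replacing `1 / fourier fε` by `fourier G` turns the primitive
into an average, with the integrable weight `K_h ⋆ G`, of increments of the empirical distribution
function of the observations, so the Glivenko–Cantelli theorem (`tendsto_measure_empMeas_Iic`)
controls the stochastic error. In the remainder the factor `t` compensates the division, and the bound
for the density applies (`norm_integral_estimator_sub_le`). The same splitting shows that the
estimator of the distribution function has a limit at infinity for every sample, the remainder being
covered by the Riemann–Lebesgue lemma (`exists_tendsto_cdfEst`). The bias of the primitive vanishes
because `F` is Lipschitz. Both estimates are joined in `tendsto_measure_estimator_dev`.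

Uniform closeness on `[0, ∞)` forces the limit at infinity to be close to `1`, so the normalized
estimator inherits the closeness, and the stability of the majorant applies to it as well.
-/

namespace Deconv

/-! ### Least concave majorants -/

section LeastConcaveMajorant

variable {θ θ₁ θ₂ g : ℝ → ℝ} {x y η d : ℝ}

/-- The least concave majorant lies below every bounded concave majorant. -/
theorem lcMajorant_le (hg : BoundedOn g (Ici 0)) (hconc : ConcaveOn ℝ (Ici 0) g)
    (hle : ∀ z ∈ Ici (0 : ℝ), θ z ≤ g z) (hx : 0 ≤ x) : lcMajorant θ x ≤ g x := by
  refine csInf_le ⟨θ x, ?_⟩ ⟨g, hg, hconc, hle, rfl⟩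
  rintro _ ⟨g', -, -, h', rfl⟩
  exact h' x hx

theorem le_lcMajorant_of_forall (hθ : BoundedOn θ (Ici 0)) {c : ℝ}
    (hc : ∀ g : ℝ → ℝ, BoundedOn g (Ici 0) → ConcaveOn ℝ (Ici 0) g →
      (∀ z ∈ Ici (0 : ℝ), θ z ≤ g z) → c ≤ g x) : c ≤ lcMajorant θ x := by
  obtain ⟨B, hB⟩ := hθ
  refine le_csInf ⟨B, fun _ => B, ⟨|B|, fun _ _ => le_rfl⟩, concaveOn_const _ (convex_Ici 0),
    fun z hz => (le_abs_self _).trans (hB z hz), rfl⟩ ?_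
  rintro _ ⟨g, h1, h2, h3, rfl⟩
  exact hc g h1 h2 h3

theorem le_lcMajorant (hθ : BoundedOn θ (Ici 0)) (hx : 0 ≤ x) : θ x ≤ lcMajorant θ x :=
  le_lcMajorant_of_forall hθ fun _ _ _ h => h x hx

theorem concaveOn_lcMajorant (hθ : BoundedOn θ (Ici 0)) : ConcaveOn ℝ (Ici 0) (lcMajorant θ) := by
  refine ⟨convex_Ici 0, fun x hx y hy a b ha hb hab => ?_⟩
  refine le_lcMajorant_of_forall hθ fun g h1 h2 h3 => ?_
  have h := h2.2 hx hy ha hb hab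
  have hx' := mul_le_mul_of_nonneg_left (lcMajorant_le h1 h2 h3 hx) ha
  have hy' := mul_le_mul_of_nonneg_left (lcMajorant_le h1 h2 h3 hy) hb
  simp only [smul_eq_mul] at h ⊢
  linarith

theorem boundedOn_lcMajorant (hθ : BoundedOn θ (Ici 0)) : BoundedOn (lcMajorant θ) (Ici 0) := by
  obtain ⟨B, hB⟩ := id hθ
  refine ⟨B, fun x hx => abs_le.2 ⟨?_, ?_⟩⟩
  · exact (neg_le_of_abs_le (hB x hx)).trans (le_lcMajorant hθ hx)
  · exact lcMajorant_le (g := fun _ => B) ⟨|B|, fun _ _ => le_rfl⟩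
      (concaveOn_const _ (convex_Ici 0)) (fun z hz => (le_abs_self _).trans (hB z hz)) hx

theorem BoundedOn.min (h₁ : BoundedOn θ₁ (Ici 0)) (h₂ : ∃ c, ∀ z ∈ Ici (0 : ℝ), c ≤ θ₂ z) :
    BoundedOn (fun z => min (θ₁ z) (θ₂ z)) (Ici 0) := by
  obtain ⟨B, hB⟩ := h₁
  obtain ⟨c, hc⟩ := h₂
  refine ⟨max B (-c), fun z hz => abs_le.2 ⟨?_, ?_⟩⟩
  · have := abs_le.1 (hB z hz)
    refine le_min ?_ ?_
    · linarith [le_max_left B (-c)]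
    · linarith [le_max_right B (-c), hc z hz]
  · exact (min_le_left _ _).trans (((abs_le.1 (hB z hz)).2).trans (le_max_left _ _))

theorem lcMajorant_le_add (h₂ : BoundedOn θ₂ (Ici 0))
    (h : ∀ z ∈ Ici (0 : ℝ), θ₁ z ≤ θ₂ z + η) (hx : 0 ≤ x) :
    lcMajorant θ₁ x ≤ lcMajorant θ₂ x + η := by
  obtain ⟨B, hB⟩ := boundedOn_lcMajorant h₂
  refine lcMajorant_le (g := fun z => lcMajorant θ₂ z + η) ⟨B + |η|, fun z hz => ?_⟩
    ((concaveOn_lcMajorant h₂).add_const η) (fun z hz => ?_) hx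
  · exact (abs_add_le _ _).trans (by gcongr; exact hB z hz)
  · exact (h z hz).trans (by gcongr; exact le_lcMajorant h₂ hz)

theorem abs_lcMajorant_sub_le (h₁ : BoundedOn θ₁ (Ici 0)) (h₂ : BoundedOn θ₂ (Ici 0))
    (h : ∀ z ∈ Ici (0 : ℝ), |θ₁ z - θ₂ z| ≤ η) (hx : 0 ≤ x) :
    |lcMajorant θ₁ x - lcMajorant θ₂ x| ≤ η := by
  have a := lcMajorant_le_add (θ₁ := θ₁) (η := η) h₂
    (fun z hz => by linarith [(abs_le.1 (h z hz)).2]) hx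
  have b := lcMajorant_le_add (θ₁ := θ₂) (η := η) h₁
    (fun z hz => by linarith [(abs_le.1 (h z hz)).1]) hx
  exact abs_le.2 ⟨by linarith, by linarith⟩

/-- A line above `θ` lies above the majorant, since the minimum of the majorant and the line is again
a concave majorant. The line need not be bounded on `[0, ∞)`; `hlow` says that the minimum is. -/
theorem lcMajorant_le_line (hθ : BoundedOn θ (Ici 0)) {a b : ℝ}
    (h : ∀ z ∈ Ici (0 : ℝ), θ z ≤ a + b * z)
    (hlow : ∃ c, ∀ z ∈ Ici (0 : ℝ), lcMajorant θ z ≤ a + b * z ∨ c ≤ a + b * z) (hx : 0 ≤ x) :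
    lcMajorant θ x ≤ a + b * x := by
  obtain ⟨B, hB⟩ := boundedOn_lcMajorant hθ
  obtain ⟨c, hc⟩ := hlow
  have hlin : ConcaveOn ℝ (Ici (0 : ℝ)) (fun z => a + b * z) := by
    refine ⟨convex_Ici 0, fun u _ v _ s t _ _ hst => le_of_eq ?_⟩
    simp only [smul_eq_mul]
    linear_combination a * hst
  have := lcMajorant_le (g := fun z => min (lcMajorant θ z) (a + b * z)) (θ := θ) (x := x)
    (BoundedOn.min ⟨B, hB⟩ ⟨min c (-B), fun z hz => ?_⟩)
    ((concaveOn_lcMajorant hθ).inf hlin) (fun z hz => le_min (le_lcMajorant hθ hz) (h z hz)) hx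
  · exact this.trans (min_le_right _ _)
  · rcases hc z hz with h' | h'
    · exact (min_le_right _ _).trans ((neg_le_of_abs_le (hB z hz)).trans h')
    · exact (min_le_left _ _).trans h'

/-- A bound of `θ₁ - θ₂` by a line through the origin passes to the majorants. This is what compares
their slopes at the origin. -/
theorem lcMajorant_le_add_mul (h₁ : BoundedOn θ₁ (Ici 0)) (h₂ : BoundedOn θ₂ (Ici 0))
    (hd : 0 ≤ d) (h : ∀ z ∈ Ici (0 : ℝ), θ₁ z ≤ θ₂ z + d * z) (hx : 0 ≤ x) :
    lcMajorant θ₁ x ≤ lcMajorant θ₂ x + d * x := by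
  obtain ⟨B, hB⟩ := boundedOn_lcMajorant h₂
  have hlin : ConcaveOn ℝ (Ici (0 : ℝ)) (fun z => d * z) := by
    refine ⟨convex_Ici 0, fun u _ v _ s t _ _ hst => le_of_eq ?_⟩
    simp only [smul_eq_mul]
    ring
  have := lcMajorant_le (g := fun z => min (lcMajorant θ₁ z) (lcMajorant θ₂ z + d * z))
    (θ := θ₁) (x := x)
    (BoundedOn.min (boundedOn_lcMajorant h₁) ⟨-B, fun z hz => ?_⟩)
    ((concaveOn_lcMajorant h₁).inf ((concaveOn_lcMajorant h₂).add hlin))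
    (fun z hz => le_min (le_lcMajorant h₁ hz) ?_) hx
  · exact this.trans (min_le_right _ _)
  · have := neg_le_of_abs_le (hB z hz)
    have h3 : 0 ≤ d * z := mul_nonneg hd hz
    linarith
  · exact (h z hz).trans (by gcongr; exact le_lcMajorant h₂ hz)

theorem lcMajorant_zero {L : ℝ} (hθ : BoundedOn θ (Ici 0)) (hL : 0 ≤ L)
    (h : ∀ z ∈ Ici (0 : ℝ), θ z ≤ θ 0 + L * z) : lcMajorant θ 0 = θ 0 := by
  refine le_antisymm ?_ (le_lcMajorant hθ le_rfl)
  have := lcMajorant_le_line (x := 0) hθ h ⟨θ 0, fun z hz => Or.inr ?_⟩ le_rfl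
  · simpa using this
  · have : 0 ≤ L * z := mul_nonneg hL hz
    linarith

/-- A least concave majorant has no kink at a point where `θ` is differentiable: at a contact point
the one-sided slopes are squeezed by the derivative of `θ`, and a kink away from `θ` could be cut
off by a line. -/
theorem differentiableAt_lcMajorant (hθ : BoundedOn θ (Ici 0)) (hx : 0 < x)
    (hd : DifferentiableAt ℝ θ x) : DifferentiableAt ℝ (lcMajorant θ) x := by
  have hconc := concaveOn_lcMajorant hθ
  set M := lcMajorant θ with hM
  have hint : x ∈ interior (Ici (0 : ℝ)) := by rwa [interior_Ici]
  obtain ⟨q, hq⟩ : ∃ q, HasDerivWithinAt M q (Ioi x) x := by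
    have := (hconc.neg.differentiableWithinAt_Ioi_of_mem_interior hint).neg
    rw [neg_neg] at this
    exact ⟨_, this.hasDerivWithinAt⟩
  obtain ⟨p, hp⟩ : ∃ p, HasDerivWithinAt M p (Iio x) x := by
    have := (hconc.neg.differentiableWithinAt_Iio_of_mem_interior hint).neg
    rw [neg_neg] at this
    exact ⟨_, this.hasDerivWithinAt⟩
  have hright : ∀ z, x < z → M z ≤ M x + q * (z - x) := fun z hz => by
    have := hconc.slope_le_of_hasDerivWithinAt_Ioi (mem_Ici.2 hx.le)
      (mem_Ici.2 (hx.le.trans hz.le)) hz hq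
    rw [slope_def_field, div_le_iff₀ (sub_pos.2 hz)] at this
    linarith
  have hleft : ∀ z, 0 ≤ z → z < x → M z ≤ M x + p * (z - x) := fun z h0 hz => by
    have := hconc.le_slope_of_hasDerivWithinAt_Iio (mem_Ici.2 h0) (mem_Ici.2 hx.le) hz hp
    rw [slope_def_field, le_div_iff₀ (sub_pos.2 hz)] at this
    linarith
  have hqp : q ≤ p := by
    have h1 := hconc.2 (mem_Ici.2 (by linarith : (0 : ℝ) ≤ x / 2))
      (mem_Ici.2 (by linarith : (0 : ℝ) ≤ 3 * x / 2))
      (by norm_num : (0 : ℝ) ≤ 1 / 2) (by norm_num : (0 : ℝ) ≤ 1 / 2) (by norm_num)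
    have hs : Tendsto (slope M x) (𝓝[>] x) (𝓝 q) := by
      simpa using hasDerivWithinAt_iff_tendsto_slope.1 hq
    have hs' : Tendsto (slope M x) (𝓝[<] x) (𝓝 p) := by
      simpa using hasDerivWithinAt_iff_tendsto_slope.1 hp
    refine le_of_tendsto hs (eventually_nhdsWithin_of_forall fun z hz => ?_)
    have h0 : ∀ᶠ y in 𝓝[<] x, 0 ≤ y :=
      Filter.Eventually.filter_mono nhdsWithin_le_nhds (Ici_mem_nhds hx)
    refine ge_of_tendsto hs' ?_
    filter_upwards [h0, self_mem_nhdsWithin] with y hy hyx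
    refine hconc.slope_anti (mem_Ici.2 hx.le) ⟨hy, ne_of_lt hyx⟩
      ⟨mem_Ici.2 (hx.le.trans (le_of_lt hz)), ne_of_gt hz⟩ ((le_of_lt hyx).trans (le_of_lt hz))
  rcases hqp.eq_or_lt with rfl | hlt
  · refine HasDerivAt.differentiableAt (f' := q) ?_
    have := hp.union hq
    rw [Iio_union_Ioi] at this
    rw [hasDerivAt_iff_tendsto_slope]
    rw [hasDerivWithinAt_iff_tendsto_slope] at this
    simpa [compl_eq_univ_sdiff, sdiff_sdiff] using this
  exfalso
  rcases (le_lcMajorant hθ hx.le).eq_or_lt with heq | hgap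
  · -- at a contact point the derivative of `θ` would lie above `p` and below `q`
    obtain ⟨t, ht⟩ : ∃ t, HasDerivAt θ t x := ⟨_, hd.hasDerivAt⟩
    have hs := hasDerivAt_iff_tendsto_slope.1 ht
    have h1 : t ≤ q := by
      refine le_of_tendsto (hs.mono_left (nhdsWithin_mono x (s := Ioi x) fun z hz => ne_of_gt hz))
        (eventually_nhdsWithin_of_forall fun z hz => ?_)
      have hz' : x < z := hz
      rw [slope_def_field, div_le_iff₀ (sub_pos.2 hz')]
      have := (le_lcMajorant hθ (hx.le.trans hz'.le)).trans (hright z hz')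
      linarith
    have h2 : p ≤ t := by
      have h0 : ∀ᶠ y in 𝓝[<] x, 0 ≤ y :=
        Filter.Eventually.filter_mono nhdsWithin_le_nhds (Ici_mem_nhds hx)
      refine ge_of_tendsto
        (hs.mono_left (nhdsWithin_mono x (s := Iio x) fun z hz => ne_of_lt hz)) ?_
      filter_upwards [h0, self_mem_nhdsWithin] with z hz0 hz
      have hz' : z < x := hz
      rw [slope_comm, slope_def_field, le_div_iff₀ (sub_pos.2 hz')]
      have := (le_lcMajorant hθ hz0).trans (hleft z hz0 hz')
      linarith
    linarith
  · -- away from contact, the line of slope `(p + q) / 2` a little below `M x` cuts the kink off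
    set m := (M x - θ x) / 2 with hm
    have hm0 : 0 < m := by rw [hm]; linarith
    set s := (p + q) / 2 with hs
    obtain ⟨r, hr, hball⟩ : ∃ r > 0, ∀ z, |z - x| < r → θ z < M x - m := by
      have := hd.continuousAt.eventually
        (Iio_mem_nhds (show θ x < M x - m by rw [hm, hM]; linarith))
      obtain ⟨r, hr, h⟩ := Metric.eventually_nhds_iff.1 this
      exact ⟨r, hr, fun z hz => h (by rwa [Real.dist_eq])⟩
    -- within distance `r'` of `x` the line moves by at most `m / 2`, so it stays above `θ`; outside,
    -- the drop `κ` is absorbed by the difference of the one-sided slopes, so it stays above `M`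
    set r' := min r (m / 2 / (|s| + 1)) with hr'
    have hr'0 : 0 < r' := lt_min hr (by positivity)
    have hsr : |s| * r' ≤ m / 2 := by
      have h1 : r' * (|s| + 1) ≤ m / 2 := by
        rw [← le_div_iff₀ (by positivity)]
        exact min_le_right _ _
      nlinarith [abs_nonneg s]
    set κ := min (m / 2) (r' * ((p - q) / 2)) with hκ
    have hκ0 : 0 < κ := lt_min (by positivity) (mul_pos hr'0 (by linarith))
    have hκ1 : κ ≤ m / 2 := min_le_left _ _
    have hκ2 : κ ≤ r' * ((p - q) / 2) := min_le_right _ _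
    have key : ∀ z ∈ Ici (0 : ℝ), (M x - κ - s * x + s * z) ≥ M z ∨
        (θ z ≤ M x - κ - s * x + s * z ∧ M x - m ≤ M x - κ - s * x + s * z) := by
      intro z hz
      rcases lt_or_ge |z - x| r' with hzr | hzr
      · right
        have h1 : -(m / 2) ≤ s * (z - x) := by
          have : |s * (z - x)| ≤ m / 2 := by
            rw [abs_mul]
            exact (mul_le_mul_of_nonneg_left hzr.le (abs_nonneg s)).trans hsr
          exact (abs_le.1 this).1
        have h2 := hball z (hzr.trans_le (min_le_left _ _))
        constructor <;> nlinarith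
      · left
        rcases lt_trichotomy z x with h | h | h
        · rw [abs_of_neg (by linarith)] at hzr
          have := hleft z hz h
          have h3 : r' * ((p - q) / 2) ≤ (x - z) * ((p - q) / 2) :=
            mul_le_mul_of_nonneg_right (by linarith) (by linarith)
          rw [hs]
          nlinarith
        · rw [h, sub_self, abs_zero] at hzr
          linarith
        · rw [abs_of_pos (by linarith)] at hzr
          have := hright z h
          have h3 : r' * ((p - q) / 2) ≤ (z - x) * ((p - q) / 2) :=
            mul_le_mul_of_nonneg_right (by linarith) (by linarith)
          rw [hs]
          nlinarith
    have := lcMajorant_le_line (x := x) (a := M x - κ - s * x) (b := s) hθ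
      (fun z hz => (key z hz).elim (fun h => (le_lcMajorant hθ hz).trans h) fun h => h.1)
      ⟨M x - m, fun z hz => (key z hz).imp id fun h => h.2⟩ hx.le
    rw [← hM] at this
    linarith

/-- At the origin the difference quotients of the majorant increase towards `0` and are bounded by
`L`, so they converge. -/
theorem differentiableWithinAt_lcMajorant_zero {L : ℝ} (hθ : BoundedOn θ (Ici 0)) (hL : 0 ≤ L)
    (h : ∀ z ∈ Ici (0 : ℝ), θ z ≤ θ 0 + L * z) :
    DifferentiableWithinAt ℝ (lcMajorant θ) (Ici 0) 0 := by
  have hle : ∀ z ∈ Ici (0 : ℝ), lcMajorant θ z ≤ θ 0 + L * z := fun z hz =>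
    lcMajorant_le_line hθ h ⟨θ 0, fun z hz => Or.inr
      (by have : 0 ≤ L * z := mul_nonneg hL hz; linarith)⟩ hz
  have hanti : AntitoneOn (slope (lcMajorant θ) 0) (Ioo 0 1) := fun a ha b hb hab =>
    (concaveOn_lcMajorant hθ).slope_anti (mem_Ici.2 le_rfl) ⟨mem_Ici.2 ha.1.le, ha.1.ne'⟩
      ⟨mem_Ici.2 hb.1.le, hb.1.ne'⟩ hab
  have hlim := hanti.tendsto_nhdsWithin_Ioo_right (by simp) ⟨L, by
    rintro _ ⟨z, hz, rfl⟩
    rw [slope_def_field, div_le_iff₀ (by linarith [hz.1]), lcMajorant_zero hθ hL h]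
    linarith [hle z hz.1.le]⟩
  refine HasDerivWithinAt.differentiableWithinAt
    (f' := sSup (slope (lcMajorant θ) 0 '' Ioo 0 1)) (hasDerivWithinAt_iff_tendsto_slope.2 ?_)
  rwa [Ici_sdiff_left]

/-- The standing assumption on the functions whose majorants are compared: a bounded function on
`[0, ∞)` with bounded derivative `g` (one-sided at `0`). -/
structure BoundedC1 (θ g : ℝ → ℝ) : Prop where
  bounded : BoundedOn θ (Ici 0)
  bounded_deriv : BoundedOn g (Ici 0)
  hasDeriv : ∀ x ∈ Ici (0 : ℝ), HasDerivWithinAt θ (g x) (Ici 0) x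

theorem BoundedC1.le_line (h : BoundedC1 θ g) :
    ∃ L, 0 ≤ L ∧ ∀ z ∈ Ici (0 : ℝ), θ z ≤ θ 0 + L * z := by
  obtain ⟨L, hL⟩ := h.bounded_deriv
  refine ⟨L, (abs_nonneg _).trans (hL 0 (mem_Ici.2 le_rfl)), fun z hz => ?_⟩
  have := (convex_Ici (0 : ℝ)).norm_image_sub_le_of_norm_hasDerivWithin_le h.hasDeriv hL
    (mem_Ici.2 le_rfl) hz
  rw [Real.norm_eq_abs, Real.norm_eq_abs, sub_zero, abs_of_nonneg (mem_Ici.1 hz)] at this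
  linarith [le_abs_self (θ z - θ 0)]

theorem BoundedC1.lcMajorant_zero (h : BoundedC1 θ g) : lcMajorant θ 0 = θ 0 := by
  obtain ⟨L, hL, hle⟩ := h.le_line
  exact Deconv.lcMajorant_zero h.bounded hL hle

theorem BoundedC1.differentiableOn (h : BoundedC1 θ g) :
    DifferentiableOn ℝ (lcMajorant θ) (Ici 0) := by
  intro x hx
  rcases (mem_Ici.1 hx).eq_or_lt with rfl | hx'
  · obtain ⟨L, hL, hle⟩ := h.le_line
    exact differentiableWithinAt_lcMajorant_zero h.bounded hL hle
  · exact (differentiableAt_lcMajorant h.bounded hx'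
      ((h.hasDeriv x hx).hasDerivAt (Ici_mem_nhds hx')).differentiableAt).differentiableWithinAt

theorem BoundedC1.hasDerivWithinAt (h : BoundedC1 θ g) (hx : 0 ≤ x) :
    HasDerivWithinAt (lcMajorant θ) (slopeFn (lcMajorant θ) x) (Ici 0) x :=
  (h.differentiableOn x hx).hasDerivWithinAt

theorem BoundedC1.antitoneOn_slope (h : BoundedC1 θ g) :
    AntitoneOn (slopeFn (lcMajorant θ)) (Ici 0) :=
  (concaveOn_lcMajorant h.bounded).antitoneOn_derivWithin h.differentiableOn

theorem BoundedC1.sub_le_slope_mul (h : BoundedC1 θ g) (hx : 0 ≤ x) (hxy : x < y) :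
    lcMajorant θ y - lcMajorant θ x ≤ slopeFn (lcMajorant θ) x * (y - x) := by
  have := (concaveOn_lcMajorant h.bounded).slope_le_of_hasDerivWithinAt (mem_Ici.2 hx)
    (mem_Ici.2 (hx.trans hxy.le)) hxy (h.hasDerivWithinAt hx)
  rwa [slope_def_field, div_le_iff₀ (sub_pos.2 hxy)] at this

theorem BoundedC1.slope_mul_le_sub (h : BoundedC1 θ g) (hx : 0 ≤ x) (hxy : x < y) :
    slopeFn (lcMajorant θ) y * (y - x) ≤ lcMajorant θ y - lcMajorant θ x := by
  have := (concaveOn_lcMajorant h.bounded).le_slope_of_hasDerivWithinAt (mem_Ici.2 hx)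
    (mem_Ici.2 (hx.trans hxy.le)) hxy (h.hasDerivWithinAt (hx.trans hxy.le))
  rwa [slope_def_field, le_div_iff₀ (sub_pos.2 hxy)] at this

theorem BoundedC1.slope_nonneg (h : BoundedC1 θ g) (hx : 0 ≤ x) :
    0 ≤ slopeFn (lcMajorant θ) x := by
  -- a negative slope would force the bounded function `lcMajorant θ` to `-∞`
  by_contra! hneg
  obtain ⟨B, hB⟩ := boundedOn_lcMajorant h.bounded
  set s := slopeFn (lcMajorant θ) x
  have hB0 : 0 ≤ B := (abs_nonneg _).trans (hB 0 (mem_Ici.2 le_rfl))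
  have hpos : 0 < (2 * B + 1) / -s := div_pos (by linarith) (by linarith)
  have := h.sub_le_slope_mul hx (lt_add_of_pos_right x hpos)
  have h1 := abs_le.1 (hB x hx)
  have h2 := abs_le.1 (hB (x + (2 * B + 1) / -s) (mem_Ici.2 (by linarith)))
  have h3 : s * (x + (2 * B + 1) / -s - x) = -(2 * B + 1) := by
    have := hneg.ne
    field_simp
    ring
  linarith

/-- The slope is continuous: it is monotone and, as a derivative, has the Darboux property. -/
theorem BoundedC1.continuousOn_slope (h : BoundedC1 θ g) :
    ContinuousOn (slopeFn (lcMajorant θ)) (Ici 0) := by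
  have hanti := h.antitoneOn_slope
  set s := slopeFn (lcMajorant θ) with hs
  -- the Darboux property
  have darboux : ∀ a b m : ℝ, 0 ≤ a → a ≤ b → m < s a → s b < m → ∃ c ∈ Ioo a b, s c = m := by
    intro a b m ha hab hma hbm
    exact exists_hasDerivWithinAt_eq_of_lt_of_gt hab
      (fun x hx => (h.hasDerivWithinAt (ha.trans hx.1)).mono fun y hy => mem_Ici.2 (ha.trans hy.1))
      hma hbm
  intro x hx
  rw [Metric.continuousWithinAt_iff]
  intro ε hε
  have hx0 : (0 : ℝ) ≤ x := hx
  obtain ⟨b, hxb, hb⟩ : ∃ b, x < b ∧ s x - ε < s b := by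
    rcases lt_or_ge (s x - ε) (s (x + 1)) with h1 | h1
    · exact ⟨_, by linarith, h1⟩
    · obtain ⟨c, hc, hc'⟩ := darboux x (x + 1) (s x - ε / 2) hx0 (by linarith) (by linarith)
        (by linarith)
      exact ⟨c, hc.1, by linarith⟩
  obtain ⟨a, hax, ha⟩ : ∃ a, a < x ∧ ∀ z ∈ Ici (0 : ℝ), a < z → s z < s x + ε := by
    rcases hx0.eq_or_lt with rfl | hpos
    · exact ⟨-1, by norm_num, fun z hz _ => by linarith [hanti hx hz (mem_Ici.1 hz)]⟩
    rcases lt_or_ge (s 0) (s x + ε) with h1 | h1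
    · exact ⟨0, hpos, fun z hz _ =>
        (hanti (mem_Ici.2 le_rfl) hz (mem_Ici.1 hz)).trans_lt h1⟩
    · obtain ⟨c, hc, hc'⟩ := darboux 0 x (s x + ε / 2) le_rfl hx0 (by linarith) (by linarith)
      exact ⟨c, hc.2, fun z hz hcz => by linarith [hanti (mem_Ici.2 hc.1.le) hz hcz.le]⟩
  refine ⟨min (b - x) (x - a), lt_min (by linarith) (by linarith), fun z hz hzx => ?_⟩
  rw [Real.dist_eq] at hzx ⊢
  have h1 := abs_lt.1 (hzx.trans_le (min_le_left _ _))
  have h2 := abs_lt.1 (hzx.trans_le (min_le_right _ _))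
  have h3 := hanti hz (mem_Ici.2 (hx0.trans hxb.le)) (by linarith)
  have h4 := ha z hz (by linarith)
  exact abs_lt.2 ⟨by linarith, by linarith⟩

/-- Uniform continuity of the slope on `[0, ∞)`, in the one-sided form that matters for a decreasing
function. -/
theorem BoundedC1.exists_slope_le_add (h : BoundedC1 θ g) {ε : ℝ} (hε : 0 < ε) :
    ∃ δ > 0, ∀ x y : ℝ, 0 ≤ x → 0 ≤ y → y ≤ x + δ →
      slopeFn (lcMajorant θ) x ≤ slopeFn (lcMajorant θ) y + ε := by
  have hanti := h.antitoneOn_slope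
  have hcont := h.continuousOn_slope
  have hpos : ∀ x, 0 ≤ x → 0 ≤ slopeFn (lcMajorant θ) x := fun x hx => h.slope_nonneg hx
  set s := slopeFn (lcMajorant θ) with hs
  -- the even extension is uniformly continuous, being continuous with a limit at infinity
  have hc : Continuous fun x : ℝ => s |x| :=
    hcont.comp_continuous continuous_abs fun x => mem_Ici.2 (abs_nonneg x)
  have hanti' : Antitone fun x : ℝ => s (max x 0) := fun a b hab =>
    hanti (mem_Ici.2 (le_max_right _ _)) (mem_Ici.2 (le_max_right _ _)) (max_le_max hab le_rfl)
  have hlim := tendsto_atTop_ciInf hanti' ⟨0, by rintro _ ⟨x, rfl⟩; exact hpos _ (le_max_right _ _)⟩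
  have hlim' := hlim.comp (tendsto_norm_cocompact_atTop (E := ℝ))
  have huc : UniformContinuous fun x : ℝ => s |x| :=
    hc.uniformContinuous_of_tendsto_cocompact (hlim'.congr fun x => by
      simp [Real.norm_eq_abs])
  obtain ⟨δ, hδ, hd⟩ := Metric.uniformContinuous_iff.1 huc ε hε
  refine ⟨δ / 2, by positivity, fun x y hx hy hyx => ?_⟩
  rcases le_total y x with h1 | h1
  · linarith [hanti hy hx h1]
  · have := hd (a := x) (b := y) (by rw [Real.dist_eq, abs_lt]; constructor <;> linarith)
    rw [Real.dist_eq, abs_of_nonneg hx, abs_of_nonneg hy] at this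
    linarith [(abs_lt.1 this).2]

/-- Comparison of the slopes at the origin. It needs closeness of the derivatives: uniform
closeness of the functions alone does not control the slope of the majorant at the endpoint. -/
theorem BoundedC1.slope_zero_le {g₁ g₂ : ℝ → ℝ} (h₁ : BoundedC1 θ₁ g₁) (h₂ : BoundedC1 θ₂ g₂)
    (h0 : θ₁ 0 = θ₂ 0) (hd : ∀ z ∈ Ici (0 : ℝ), g₁ z ≤ g₂ z + d) (hd0 : 0 ≤ d) :
    slopeFn (lcMajorant θ₁) 0 ≤ slopeFn (lcMajorant θ₂) 0 + d := by
  have hle : ∀ z ∈ Ici (0 : ℝ), θ₁ z ≤ θ₂ z + d * z := by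
    have hder : ∀ z ∈ Ici (0 : ℝ), HasDerivWithinAt (fun z => θ₂ z + d * z - θ₁ z)
        (g₂ z + d * 1 - g₁ z) (Ici 0) z := fun z hz =>
      ((h₂.hasDeriv z hz).add ((hasDerivWithinAt_id z _).const_mul d)).sub (h₁.hasDeriv z hz)
    have hmono : MonotoneOn (fun z => θ₂ z + d * z - θ₁ z) (Ici 0) := by
      refine monotoneOn_of_deriv_nonneg (convex_Ici 0)
        (fun z hz => (hder z hz).continuousWithinAt) (fun z hz => ?_) fun z hz => ?_
      · exact ((hder z (interior_subset hz)).mono interior_subset).differentiableWithinAt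
      · rw [interior_Ici] at hz
        rw [((hder z (mem_Ici.2 (le_of_lt hz))).hasDerivAt (Ici_mem_nhds hz)).deriv]
        linarith [hd z (mem_Ici.2 (le_of_lt hz))]
    intro z hz
    have := hmono (mem_Ici.2 le_rfl) hz (mem_Ici.1 hz)
    simp only [mul_zero, add_zero, h0, sub_self] at this
    linarith
  have hs₁ := hasDerivWithinAt_iff_tendsto_slope.1 (h₁.hasDerivWithinAt le_rfl)
  have hs₂ := hasDerivWithinAt_iff_tendsto_slope.1 (h₂.hasDerivWithinAt le_rfl)
  rw [Ici_sdiff_left] at hs₁ hs₂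
  refine le_of_tendsto_of_tendsto hs₁ (hs₂.add_const d)
    (eventually_nhdsWithin_of_forall fun z hz => ?_)
  have hz' : (0 : ℝ) < z := hz
  have := lcMajorant_le_add_mul h₁.bounded h₂.bounded hd0 hle hz'.le
  simp only [slope_def_field]
  rw [h₁.lcMajorant_zero, h₂.lcMajorant_zero, h0,
    ← sub_nonneg]
  have h3 : (lcMajorant θ₂ z - θ₂ 0) / (z - 0) + d - (lcMajorant θ₁ z - θ₂ 0) / (z - 0)
      = (lcMajorant θ₂ z + d * z - lcMajorant θ₁ z) / z := by
    rw [sub_zero]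
    field_simp
    ring
  rw [h3]
  exact div_nonneg (by linarith) hz'.le

/-- Stability of the least concave majorant and of its slope, at a fixed function `θ`. The slopes are
compared with difference quotients over a fixed step `r`, except for the upper bound within distance
`r` of the origin, where no step to the left is possible and `slope_zero_le` takes over. -/
theorem BoundedC1.exists_stability (h : BoundedC1 θ g) {δ : ℝ} (hδ : 0 < δ) :
    ∃ η > 0, ∀ θ₁ g₁ : ℝ → ℝ, BoundedC1 θ₁ g₁ → θ₁ 0 = θ 0 →
      (∀ z ∈ Ici (0 : ℝ), |θ₁ z - θ z| ≤ η) → (∀ z ∈ Ici (0 : ℝ), |g₁ z - g z| ≤ η) →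
      ∀ x ∈ Ici (0 : ℝ), |lcMajorant θ₁ x - lcMajorant θ x| ≤ δ ∧
        |slopeFn (lcMajorant θ₁) x - slopeFn (lcMajorant θ) x| ≤ δ := by
  obtain ⟨r, hr, hmod⟩ := h.exists_slope_le_add (half_pos hδ)
  -- an error `η` in the majorant changes a difference quotient over the step `r` by `2 η / r`
  have hη : 0 < min (δ / 2) (r * (δ / 4)) := lt_min (by positivity) (by positivity)
  refine ⟨min (δ / 2) (r * (δ / 4)), hη, ?_⟩
  intro θ₁ g₁ h₁ h0 hθ hg x hx
  set η := min (δ / 2) (r * (δ / 4))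
  have hη1 : η ≤ δ / 2 := min_le_left _ _
  have hη2 : η ≤ r * (δ / 4) := min_le_right _ _
  have hM : ∀ z ∈ Ici (0 : ℝ), |lcMajorant θ₁ z - lcMajorant θ z| ≤ η := fun z hz =>
    abs_lcMajorant_sub_le h₁.bounded h.bounded hθ hz
  have hx0 : (0 : ℝ) ≤ x := hx
  refine ⟨(hM x hx).trans (by linarith), abs_le.2 ⟨?_, ?_⟩⟩
  · have a1 := h₁.sub_le_slope_mul hx0 (lt_add_of_pos_right x hr)
    have a2 := h.slope_mul_le_sub hx0 (lt_add_of_pos_right x hr)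
    have a3 := abs_le.1 (hM x hx)
    have a4 := abs_le.1 (hM (x + r) (mem_Ici.2 (by linarith)))
    have a5 := hmod x (x + r) hx0 (by linarith) le_rfl
    rw [add_sub_cancel_left] at a1 a2
    have : slopeFn (lcMajorant θ) (x + r) * r ≤ (slopeFn (lcMajorant θ₁) x + δ / 2) * r := by
      linarith
    have := le_of_mul_le_mul_right this hr
    linarith
  · rcases le_or_gt r x with hrx | hrx
    · have hxr : x - r < x := by linarith
      have a1 := h₁.slope_mul_le_sub (by linarith) hxr
      have a2 := h.sub_le_slope_mul (by linarith) hxr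
      have a3 := abs_le.1 (hM x hx)
      have a4 := abs_le.1 (hM (x - r) (mem_Ici.2 (by linarith)))
      have a5 := hmod (x - r) x (by linarith) hx0 (by linarith)
      rw [sub_sub_cancel] at a1 a2
      have : slopeFn (lcMajorant θ₁) x * r ≤ (slopeFn (lcMajorant θ) (x - r) + δ / 2) * r := by
        linarith
      have := le_of_mul_le_mul_right this hr
      linarith
    · have a1 := h₁.antitoneOn_slope (mem_Ici.2 le_rfl) hx hx0
      have a2 := h₁.slope_zero_le h h0
        (fun z hz => by linarith [(abs_le.1 (hg z hz)).2]) hη.le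
      have a3 := hmod 0 x le_rfl hx0 (by linarith)
      linarith

end LeastConcaveMajorant

/-! ### The Fourier transform -/

section Fourier

open scoped FourierTransform Convolution

variable {f g A : ℝ → ℝ} {χ ψ : ℝ → ℂ}

theorem norm_exp_I_mul_mul (t s : ℝ) : ‖Complex.exp (Complex.I * t * s)‖ = 1 := by
  have : Complex.I * t * s = ((t * s : ℝ) : ℂ) * Complex.I := by push_cast; ring
  rw [this, Complex.norm_exp_ofReal_mul_I]

theorem norm_exp_neg_I_mul_mul (t s : ℝ) : ‖Complex.exp (-(Complex.I * t * s))‖ = 1 := by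
  rw [Complex.exp_neg, norm_inv, norm_exp_I_mul_mul, inv_one]

/-- In terms of Mathlib's transforms, the signs of the exponents are exchanged and the frequencies are
rescaled by `2 π`. -/
theorem fourier_eq (g : ℝ → ℝ) (t : ℝ) :
    fourier g t = 𝓕⁻ (fun s => (g s : ℂ)) (t / (2 * Real.pi)) := by
  rw [Real.fourierInv_eq', fourier]
  congr 1
  ext s
  rw [smul_eq_mul]
  congr 2
  have : (Real.pi : ℂ) ≠ 0 := by exact_mod_cast Real.pi_ne_zero
  simp only [RCLike.inner_apply, conj_trivial]
  push_cast
  field_simp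

theorem fourierInv_eq (ψ : ℝ → ℂ) (x : ℝ) :
    fourierInv ψ x = (2 * Real.pi : ℂ)⁻¹ * 𝓕 ψ (x / (2 * Real.pi)) := by
  rw [Real.fourier_eq', fourierInv]
  congr 2
  ext s
  rw [smul_eq_mul]
  congr 2
  have : (Real.pi : ℂ) ≠ 0 := by exact_mod_cast Real.pi_ne_zero
  simp only [RCLike.inner_apply, conj_trivial]
  push_cast
  field_simp

theorem integrable_exp_mul (hg : Integrable ψ) (t : ℝ) :
    Integrable fun s : ℝ => Complex.exp (Complex.I * t * s) * ψ s := by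
  refine hg.bdd_mul (c := 1) (Continuous.aestronglyMeasurable (by fun_prop)) ?_
  exact ae_of_all _ fun s => (norm_exp_I_mul_mul t s).le

theorem integrable_exp_neg_mul (hψ : Integrable ψ) (x : ℝ) :
    Integrable fun t : ℝ => Complex.exp (-(Complex.I * t * x)) * ψ t := by
  refine hψ.bdd_mul (c := 1) (Continuous.aestronglyMeasurable (by fun_prop)) ?_
  exact ae_of_all _ fun s => (norm_exp_neg_I_mul_mul s x).le

theorem norm_fourier_le (g : ℝ → ℝ) (t : ℝ) : ‖fourier g t‖ ≤ ∫ s, |g s| := by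
  refine (norm_integral_le_integral_norm _).trans_eq ?_
  congr 1
  ext s
  rw [norm_mul, norm_exp_I_mul_mul, one_mul, Complex.norm_real, Real.norm_eq_abs]

theorem norm_fourierInv_le (ψ : ℝ → ℂ) (x : ℝ) :
    ‖fourierInv ψ x‖ ≤ (2 * Real.pi)⁻¹ * ∫ t, ‖ψ t‖ := by
  rw [fourierInv, norm_mul]
  have h1 : ‖(2 * Real.pi : ℂ)⁻¹‖ = (2 * Real.pi)⁻¹ := by
    rw [norm_inv, norm_mul, Complex.norm_real, Real.norm_eq_abs, abs_of_pos Real.pi_pos]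
    simp
  rw [h1]
  refine mul_le_mul_of_nonneg_left ((norm_integral_le_integral_norm _).trans_eq ?_)
    (by positivity)
  congr 1
  ext s
  rw [norm_mul, norm_exp_neg_I_mul_mul, one_mul]

theorem continuous_fourier (hg : Integrable g) : Continuous (fourier g) := by
  refine continuous_of_dominated (bound := fun s => |g s|)
    (fun t => (integrable_exp_mul hg.ofReal t).aestronglyMeasurable)
    (fun t => ae_of_all _ fun s => ?_) hg.abs (ae_of_all _ fun s => by fun_prop)
  rw [norm_mul, norm_exp_I_mul_mul, one_mul, Complex.norm_real, Real.norm_eq_abs]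

theorem continuous_fourierInv (hψ : Integrable ψ) : Continuous (fourierInv ψ) := by
  refine continuous_const.mul (continuous_of_dominated (bound := fun t => ‖ψ t‖)
    (fun x => (integrable_exp_neg_mul hψ x).aestronglyMeasurable)
    (fun x => ae_of_all _ fun s => ?_) hψ.norm (ae_of_all _ fun s => by fun_prop))
  rw [norm_mul, norm_exp_neg_I_mul_mul, one_mul]

theorem fourierInv_add (hχ : Integrable χ) (hψ : Integrable ψ) (x : ℝ) :
    fourierInv (fun t => χ t + ψ t) x = fourierInv χ x + fourierInv ψ x := by
  simp only [fourierInv, mul_add]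
  rw [integral_add (integrable_exp_neg_mul hχ x) (integrable_exp_neg_mul hψ x), mul_add]

theorem fourierInv_sub (hχ : Integrable χ) (hψ : Integrable ψ) (x : ℝ) :
    fourierInv (fun t => χ t - ψ t) x = fourierInv χ x - fourierInv ψ x := by
  simp only [fourierInv, mul_sub]
  rw [integral_sub (integrable_exp_neg_mul hχ x) (integrable_exp_neg_mul hψ x), mul_sub]

theorem fourier_scaled (K : ℝ → ℝ) {h : ℝ} (hh : 0 < h) (t : ℝ) :
    fourier (scaled K h) t = fourier K (h * t) := by
  have := Measure.integral_comp_div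
    (fun s : ℝ => Complex.exp (Complex.I * (h * t : ℝ) * s) * (K s : ℂ)) h
  rw [abs_of_pos hh] at this
  have h2 : (∫ s : ℝ, Complex.exp (Complex.I * (h * t : ℝ) * s) * (K s : ℂ))
      = (h : ℂ)⁻¹ * ∫ x : ℝ,
        Complex.exp (Complex.I * (h * t : ℝ) * (x / h : ℝ)) * (K (x / h) : ℂ) := by
    rw [this, Complex.real_smul, ← mul_assoc, inv_mul_cancel₀ (by exact_mod_cast hh.ne'), one_mul]
  rw [fourier, fourier, h2, ← integral_const_mul]
  congr 1
  ext x
  have h3 : Complex.I * (h * t : ℝ) * (x / h : ℝ) = Complex.I * t * x := by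
    have : (h : ℂ) ≠ 0 := by exact_mod_cast hh.ne'
    push_cast
    field_simp
  rw [h3, scaled]
  push_cast
  ring

theorem integrable_scaled {K : ℝ → ℝ} (hK : Integrable K) {h : ℝ} (hh : 0 < h) :
    Integrable (scaled K h) :=
  (hK.comp_div hh.ne').const_mul _

theorem integral_scaled_mul (K φ : ℝ → ℝ) {h : ℝ} (hh : 0 < h) :
    ∫ x, scaled K h x * φ x = ∫ v, K v * φ (h * v) := by
  have := Measure.integral_comp_div (fun v : ℝ => K v * φ (h * v)) h
  rw [abs_of_pos hh, smul_eq_mul] at this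
  rw [← inv_mul_cancel_left₀ hh.ne' (∫ v, K v * φ (h * v)), ← this, ← integral_const_mul]
  congr 1
  ext x
  rw [scaled, mul_div_cancel₀ _ hh.ne']
  ring

theorem integral_abs_scaled (K : ℝ → ℝ) {h : ℝ} (hh : 0 < h) :
    ∫ x, |scaled K h x| = ∫ v, |K v| := by
  have := integral_scaled_mul (fun x => |K x|) (fun _ => 1) hh
  simp only [mul_one] at this
  rw [← this]
  congr 1
  ext x
  rw [scaled, scaled, abs_mul, abs_of_pos (inv_pos.2 hh)]

theorem integrable_complex_ofReal (hg : Integrable g) : Integrable fun s => (g s : ℂ) :=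
  hg.ofReal

theorem fourier_convolution (hf : Integrable f) (hg : Integrable g) (t : ℝ) :
    fourier (f ⋆ g) t = fourier f t * fourier g t := by
  have := integral_convolution (ContinuousLinearMap.mul ℝ ℂ)
    (integrable_exp_mul (integrable_complex_ofReal hf) t)
    (integrable_exp_mul (integrable_complex_ofReal hg) t)
  rw [ContinuousLinearMap.mul_apply'] at this
  rw [fourier, fourier, fourier]
  refine Eq.trans ?_ this
  congr 1
  ext x
  rw [convolution_def, convolution_def, ← integral_complex_ofReal, ← integral_const_mul]
  congr 1
  ext s
  have : Complex.I * t * x = Complex.I * t * s + Complex.I * t * (x - s : ℝ) := by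
    push_cast; ring
  rw [this, Complex.exp_add, ContinuousLinearMap.mul_apply', ContinuousLinearMap.lsmul_apply,
    smul_eq_mul]
  push_cast
  ring

theorem integral_abs_convolution_le (hf : Integrable f) (hg : Integrable g) :
    ∫ x, |(f ⋆ g) x| ≤ (∫ x, |f x|) * ∫ x, |g x| := by
  have := integral_convolution (ContinuousLinearMap.lsmul ℝ ℝ : ℝ →L[ℝ] ℝ →L[ℝ] ℝ) hf.abs hg.abs
  rw [ContinuousLinearMap.lsmul_apply, smul_eq_mul] at this
  rw [← this]
  refine integral_mono (hf.integrable_convolution _ hg).abs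
    (hf.abs.integrable_convolution _ hg.abs) fun x => ?_
  rw [convolution_def, convolution_def]
  refine (abs_integral_le_integral_abs).trans_eq ?_
  congr 1
  ext s
  simp [abs_mul]

theorem integral_fourier_mul_eq (hχ : Integrable χ) (hψ : Integrable ψ) :
    ∫ x, 𝓕 χ x * ψ x = ∫ x, χ x * 𝓕 ψ x := by
  have := VectorFourier.integral_fourierIntegral_smul_eq_flip (L := innerₗ ℝ)
    Real.continuous_fourierChar continuous_inner hχ hψ
  simpa using! this

theorem integral_fourierInv_mul_eq (hχ : Integrable χ) (hψ : Integrable ψ) :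
    ∫ x, 𝓕⁻ χ x * ψ x = ∫ x, χ x * 𝓕⁻ ψ x := by
  have := integral_fourier_mul_eq hχ hψ.comp_neg
  rw [Real.fourierInv_eq_fourier_comp_neg ψ, ← this, ← integral_neg_eq_self]
  congr 1
  ext x
  rw [Real.fourierInv_eq_fourier_neg, neg_neg]

/-- Fourier inversion almost everywhere, for functions that need not be continuous: both sides have
the same integrals against smooth compactly supported functions. -/
theorem ae_fourier_fourierInv_eq {ψ : ℝ → ℂ} (hψ : Integrable ψ) (h : Integrable (𝓕⁻ ψ)) :
    ∀ᵐ x, 𝓕 (𝓕⁻ ψ) x = ψ x := by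
  have hcont : Continuous (𝓕 (𝓕⁻ ψ)) := by
    have := continuous_fourierInv h
    have h2 : 𝓕 (𝓕⁻ ψ) = fun x => (2 * Real.pi : ℂ) * fourierInv (𝓕⁻ ψ) (2 * Real.pi * x) := by
      ext x
      rw [fourierInv_eq, mul_inv_cancel_left₀ (by simp),
        mul_div_cancel_left₀ _ (by positivity)]
    rw [h2]
    fun_prop
  refine ae_eq_of_integral_contDiff_smul_eq hcont.locallyIntegrable hψ.locallyIntegrable ?_
  intro φ hφ hφc
  have hφ' := Complex.ofRealCLM.contDiff.comp hφ
  have hφc' : HasCompactSupport (Complex.ofRealCLM ∘ φ) := hφc.comp_left Complex.ofReal_zero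
  set Φ : SchwartzMap ℝ ℂ := hφc'.toSchwartzMap hφ' with hΦ
  have hinv : 𝓕⁻ (𝓕 (Φ : ℝ → ℂ)) = Φ :=
    Φ.continuous.fourierInv_fourier_eq Φ.integrable (by
      rw [← SchwartzMap.fourier_coe]
      exact (𝓕 Φ).integrable)
  have e1 := integral_fourier_mul_eq h Φ.integrable
  have e2 := integral_fourierInv_mul_eq hψ (χ := ψ) (ψ := 𝓕 (Φ : ℝ → ℂ)) (by
      rw [← SchwartzMap.fourier_coe]
      exact (𝓕 Φ).integrable)
  rw [hinv, ← e1] at e2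
  have hΦc : ∀ x, Φ x = (φ x : ℂ) := fun x => rfl
  simp only [Complex.real_smul, ← hΦc]
  simpa only [mul_comm] using e2

theorem fourierInv_fourier_ae (hA : Integrable A) (hA' : Integrable (fourier A)) :
    ∀ᵐ x, fourierInv (fourier A) x = A x := by
  have hpi : (0 : ℝ) < 2 * Real.pi := by positivity
  have h1 : 𝓕⁻ (fun s => (A s : ℂ)) = fun u => fourier A (2 * Real.pi * u) := by
    ext u
    rw [fourier_eq, mul_div_cancel_left₀ _ hpi.ne']
  have h2 : Integrable (𝓕⁻ (fun s => (A s : ℂ))) := by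
    rw [h1]
    exact hA'.comp_mul_left' hpi.ne'
  filter_upwards [ae_fourier_fourierInv_eq (integrable_complex_ofReal hA) h2] with x hx
  refine Eq.trans ?_ hx
  have h3 := fourierInv_eq (fourier A) x
  rw [h3, h1, Real.fourier_eq', Real.fourier_eq']
  have h4 := Measure.integral_comp_mul_left (fun t : ℝ =>
    Complex.exp (↑(-2 * Real.pi * inner ℝ t (x / (2 * Real.pi))) * Complex.I) • fourier A t)
    (2 * Real.pi)
  rw [abs_of_pos (inv_pos.2 hpi), Complex.real_smul] at h4
  have h5 : (((2 * Real.pi)⁻¹ : ℝ) : ℂ) = (2 * Real.pi : ℂ)⁻¹ := by push_cast; rfl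
  rw [h5] at h4
  rw [← h4]
  congr 1
  ext t
  congr 2
  have : (Real.pi : ℂ) ≠ 0 := by exact_mod_cast Real.pi_ne_zero
  simp only [RCLike.inner_apply, conj_trivial]
  push_cast
  field_simp

end Fourier

/-! ### Primitives of inverse Fourier transforms -/

section Fourier

variable {A : ℝ → ℝ} {χ ψ : ℝ → ℂ}

theorem continuous_charFun (P : Measure ℝ) [IsFiniteMeasure P] : Continuous (charFun P) := by
  have h : charFun P = fun t : ℝ => ∫ x : ℝ, Complex.exp (t * x * Complex.I) ∂P := by
    ext t
    exact charFun_apply_real t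
  rw [h]
  refine continuous_of_dominated (bound := fun _ => 1)
    (fun t => Continuous.aestronglyMeasurable (by fun_prop))
    (fun t => ae_of_all _ fun s => ?_) (integrable_const _) (ae_of_all _ fun s => by fun_prop)
  have := Complex.norm_exp_ofReal_mul_I (t * s)
  push_cast at this
  exact this.le

/-- On the Fourier side, dividing `I t * χ t` by `I t` amounts to integrating: `fourierInv χ` is an
antiderivative, up to sign. -/
theorem integral_fourierInv_mul (hχ : Integrable χ)
    (hχ' : Integrable fun t : ℝ => Complex.I * t * χ t) (x : ℝ) :
    ∫ u in (0 : ℝ)..x, fourierInv (fun t => Complex.I * t * χ t) u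
      = fourierInv χ 0 - fourierInv χ x := by
  have hder : ∀ u : ℝ, HasDerivAt (fun u => -fourierInv χ u)
      (fourierInv (fun t => Complex.I * t * χ t) u) u := by
    intro u
    have h := hasDerivAt_integral_of_dominated_loc_of_deriv_le (μ := volume) (𝕜 := ℝ) (s := univ)
      (F := fun (x : ℝ) (t : ℝ) => Complex.exp (-(Complex.I * t * x)) * χ t)
      (F' := fun (x : ℝ) (t : ℝ) => Complex.exp (-(Complex.I * t * x)) * (-(Complex.I * t * χ t)))
      (bound := fun t => ‖Complex.I * t * χ t‖) (x₀ := u) univ_mem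
      (Eventually.of_forall fun x => (integrable_exp_neg_mul hχ x).aestronglyMeasurable)
      (integrable_exp_neg_mul hχ u) (integrable_exp_neg_mul hχ'.neg u).aestronglyMeasurable
      (ae_of_all _ fun t x _ => by rw [norm_mul, norm_exp_neg_I_mul_mul, one_mul, norm_neg])
      hχ'.norm (ae_of_all _ fun t x _ => ?_)
    · have h2 : HasDerivAt (fun u => -fourierInv χ u) _ u :=
        (h.2.const_mul (2 * Real.pi : ℂ)⁻¹).neg
      refine h2.congr_deriv ?_
      rw [fourierInv, ← mul_neg, ← integral_neg]
      congr 2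
      ext t
      ring
    · have h1 : HasDerivAt (fun x : ℝ => -(Complex.I * t * x)) (-(Complex.I * t)) x := by
        have := ((hasDerivAt_id x).ofReal_comp.const_mul (Complex.I * t)).neg
        rw [Complex.ofReal_one, mul_one] at this
        exact this
      have h2 := (h1.cexp).mul_const (χ t)
      refine h2.congr_deriv ?_
      ring
  rw [intervalIntegral.integral_eq_sub_of_hasDerivAt (fun u _ => hder u)
    ((continuous_fourierInv hχ').intervalIntegrable _ _)]
  ring

/-- The Riemann–Lebesgue lemma. -/
theorem tendsto_fourierInv_atTop (χ : ℝ → ℂ) : Tendsto (fourierInv χ) atTop (𝓝 0) := by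
  have h1 : Tendsto (fun x : ℝ => x / (2 * Real.pi)) atTop (cocompact ℝ) :=
    (tendsto_id.atTop_div_const (by positivity)).mono_right atTop_le_cocompact
  have h2 := ((Real.zero_at_infty_fourier χ).comp h1).const_mul (2 * Real.pi : ℂ)⁻¹
  rw [mul_zero] at h2
  exact h2.congr fun x => (fourierInv_eq χ x).symm

theorem norm_integral_fourierInv_mul_le (hχ : Integrable χ)
    (hχ' : Integrable fun t : ℝ => Complex.I * t * χ t) (x : ℝ) :
    ‖∫ u in (0 : ℝ)..x, fourierInv (fun t => Complex.I * t * χ t) u‖ ≤ ∫ t, ‖χ t‖ := by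
  rw [integral_fourierInv_mul hχ hχ']
  have h1 := norm_fourierInv_le χ 0
  have h2 := norm_fourierInv_le χ x
  have h3 : 0 ≤ ∫ t, ‖χ t‖ := integral_nonneg fun t => norm_nonneg _
  have h4 : (2 * Real.pi)⁻¹ ≤ 1 / 2 := by
    rw [inv_eq_one_div]
    gcongr
    linarith [Real.pi_gt_three]
  have := norm_sub_le (fourierInv χ 0) (fourierInv χ x)
  nlinarith

/-- Multiplication by `charFun P` on the Fourier side is convolution with `P`. -/
theorem fourierInv_mul_charFun (hψ : Integrable ψ) (P : Measure ℝ) [IsFiniteMeasure P] (u : ℝ) :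
    fourierInv (fun t => ψ t * charFun P t) u = ∫ y, fourierInv ψ (u - y) ∂P := by
  have hint : Integrable
      (fun p : ℝ × ℝ => Complex.exp (-(Complex.I * p.1 * (u - p.2 : ℝ))) * ψ p.1)
      (volume.prod P) := by
    refine (hψ.comp_fst P).bdd_mul (c := 1) (Continuous.aestronglyMeasurable (by fun_prop)) ?_
    exact ae_of_all _ fun p => (norm_exp_neg_I_mul_mul _ _).le
  have hswap := integral_integral_swap
    (f := fun t y : ℝ => Complex.exp (-(Complex.I * t * (u - y : ℝ))) * ψ t) hint
  simp only [fourierInv]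
  rw [integral_const_mul, ← hswap]
  congr 2
  ext t
  rw [charFun_apply_real, integral_mul_const, ← mul_assoc, mul_right_comm,
    mul_comm (_ * _) (ψ t), mul_comm _ (ψ t), ← integral_const_mul]
  congr 2
  ext y
  rw [← Complex.exp_add]
  congr 1
  push_cast
  ring

theorem measurableSet_prod_Ioc (x : ℝ) :
    MeasurableSet {p : ℝ × ℝ | p.1 ∈ Ioc (-p.2) (x - p.2)} := by
  have h1 : MeasurableSet {p : ℝ × ℝ | -p.2 < p.1} := measurableSet_lt (by fun_prop) (by fun_prop)
  have h2 : MeasurableSet {p : ℝ × ℝ | p.1 ≤ x - p.2} :=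
    measurableSet_le (by fun_prop) (by fun_prop)
  exact h1.inter h2

theorem measurable_real_Ioc (P : Measure ℝ) [IsFiniteMeasure P] (x : ℝ) :
    Measurable fun z => P.real (Ioc (-z) (x - z)) := by
  have h := measurable_measure_prodMk_left (ν := P) (measurableSet_prod_Ioc x)
  have h2 : ∀ z : ℝ, Prod.mk z ⁻¹' {p : ℝ × ℝ | p.1 ∈ Ioc (-p.2) (x - p.2)}
      = Ioc (-z) (x - z) := by
    intro z
    ext y
    simp only [mem_preimage, mem_ofPred_eq, mem_Ioc]
    constructor <;> rintro ⟨h1, h2⟩ <;> constructor <;> linarith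
  simp only [h2] at h
  exact h.ennreal_toReal

theorem integrable_mul_real_Ioc (hA : Integrable A) (P : Measure ℝ) [IsFiniteMeasure P] (x : ℝ) :
    Integrable fun z => A z * P.real (Ioc (-z) (x - z)) := by
  refine hA.mul_bdd (c := P.real univ) (measurable_real_Ioc P x).aestronglyMeasurable ?_
  refine ae_of_all _ fun z => ?_
  rw [Real.norm_eq_abs, abs_of_nonneg measureReal_nonneg]
  exact measureReal_mono (subset_univ _)

/-- If `fourier A` is integrable, the primitive of the function with Fourier transform
`fourier A * charFun P` is an average of increments of the distribution function of `P`. -/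
theorem integral_fourierInv_fourier_mul_charFun (hA : Integrable A) (hA' : Integrable (fourier A))
    (P : Measure ℝ) [IsFiniteMeasure P] {x : ℝ} (hx : 0 ≤ x) :
    ∫ u in (0 : ℝ)..x, fourierInv (fun t => fourier A t * charFun P t) u
      = ((∫ z, A z * P.real (Ioc (-z) (x - z)) : ℝ) : ℂ) := by
  have hA1 := integrable_complex_ofReal hA
  have hcont := continuous_fourierInv hA'
  have hinner : ∀ y : ℝ, ∫ u in (0 : ℝ)..x, fourierInv (fourier A) (u - y)
      = ∫ z, (Ioc (-y) (x - y)).indicator (fun z => (A z : ℂ)) z := by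
    intro y
    rw [intervalIntegral.integral_comp_sub_right, integral_indicator measurableSet_Ioc, zero_sub,
      intervalIntegral.integral_of_le (by linarith)]
    exact integral_congr_ae (ae_restrict_of_ae (fourierInv_fourier_ae hA hA'))
  have hint1 : Integrable (fun p : ℝ × ℝ => fourierInv (fourier A) (p.1 - p.2))
      ((volume.restrict (Ioc 0 x)).prod P) := by
    refine Integrable.of_bound (C := (2 * Real.pi)⁻¹ * ∫ t, ‖fourier A t‖)
      (Continuous.aestronglyMeasurable (by fun_prop)) (ae_of_all _ fun p => norm_fourierInv_le _ _)
  have hint2 : Integrable (fun p : ℝ × ℝ =>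
      (Ioc (-p.1) (x - p.1)).indicator (fun z => (A z : ℂ)) p.2) (P.prod volume) := by
    have h1 : Integrable (fun p : ℝ × ℝ => (A p.2 : ℂ)) (P.prod volume) := hA1.comp_snd P
    have h2 : MeasurableSet {p : ℝ × ℝ | p.2 ∈ Ioc (-p.1) (x - p.1)} :=
      measurable_swap (measurableSet_prod_Ioc x)
    refine (h1.indicator h2).congr (ae_of_all _ fun p => ?_)
    simp only [indicator, mem_ofPred_eq]
  have h1 : ∀ u, fourierInv (fun t => fourier A t * charFun P t) u
      = ∫ y, fourierInv (fourier A) (u - y) ∂P := fun u => fourierInv_mul_charFun hA' P u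
  simp only [h1]
  rw [intervalIntegral.integral_of_le hx, integral_integral_swap hint1]
  simp only [← intervalIntegral.integral_of_le hx, hinner]
  rw [integral_integral_swap hint2, ← integral_complex_ofReal]
  congr 1
  ext z
  have h2 : ∀ y : ℝ, (Ioc (-y) (x - y)).indicator (fun z => (A z : ℂ)) z
      = (Ioc (-z) (x - z)).indicator (fun _ => (A z : ℂ)) y := by
    intro y
    simp only [indicator, mem_Ioc]
    congr 1
    apply propext
    constructor <;> rintro ⟨h1, h2⟩ <;> constructor <;> linarith
  simp only [h2]
  rw [integral_indicator_const _ measurableSet_Ioc, Complex.real_smul]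
  push_cast
  ring

/-- The average of the increments has a limit at infinity. -/
theorem tendsto_integral_mul_real_Ioc (hA : Integrable A) (P : Measure ℝ) [IsFiniteMeasure P] :
    Tendsto (fun x => ∫ z, A z * P.real (Ioc (-z) (x - z))) atTop
      (𝓝 (∫ z, A z * P.real (Ioi (-z)))) := by
  refine tendsto_integral_filter_of_dominated_convergence (fun z => |A z| * P.real univ)
    (Eventually.of_forall fun x => (integrable_mul_real_Ioc hA P x).aestronglyMeasurable)
    (Eventually.of_forall fun x => ae_of_all _ fun z => ?_) (hA.abs.mul_const _)
    (ae_of_all _ fun z => Tendsto.const_mul _ ?_)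
  · rw [norm_mul, Real.norm_eq_abs, Real.norm_eq_abs, abs_of_nonneg measureReal_nonneg]
    exact mul_le_mul_of_nonneg_left (measureReal_mono (subset_univ _)) (abs_nonneg _)
  · have h1 : Tendsto (fun x : ℝ => x - z) atTop atTop :=
      tendsto_atTop_add_const_right _ _ tendsto_id
    have h2 : Monotone fun b : ℝ => Ioc (-z) b := fun a b hab => Ioc_subset_Ioc_right hab
    have h3 : ⋃ b : ℝ, Ioc (-z) b = Ioi (-z) := iUnion_Ioc_right (-z)
    have h4 := tendsto_measure_iUnion_atTop (μ := P) h2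
    rw [h3] at h4
    exact ((ENNReal.tendsto_toReal (measure_ne_top P _)).comp h4).comp h1

end Fourier

/-! ### A local form of Wiener's lemma -/

section LocalInverse

open scoped Convolution

variable {g r W : ℝ → ℝ}

/-- The uniform density on `[0, R]`. -/
noncomputable def unif (R : ℝ) : ℝ → ℝ := (Icc 0 R).indicator fun _ => R⁻¹

theorem integrable_unif (R : ℝ) : Integrable (unif R) :=
  (integrable_indicator_iff measurableSet_Icc).2 (integrableOn_const (by simp))

theorem unif_nonneg {R : ℝ} (hR : 0 < R) (x : ℝ) : 0 ≤ unif R x :=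
  indicator_nonneg (fun _ _ => (inv_pos.2 hR).le) x

theorem integral_unif {R : ℝ} (hR : 0 < R) : ∫ x, unif R x = 1 := by
  rw [unif, integral_indicator_const _ measurableSet_Icc, Measure.real, Real.volume_Icc, sub_zero,
    ENNReal.toReal_ofReal hR.le, smul_eq_mul, mul_inv_cancel₀ hR.ne']

theorem integral_abs_unif {R : ℝ} (hR : 0 < R) : ∫ x, |unif R x| = 1 := by
  rw [← integral_unif hR]
  congr 1
  ext x
  exact abs_of_nonneg (unif_nonneg hR x)

theorem norm_one_sub_fourier_unif_le {R : ℝ} (hR : 0 < R) (t : ℝ) :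
    ‖1 - fourier (unif R) t‖ ≤ R * |t| := by
  have h1 : (1 : ℂ) = ∫ s, (unif R s : ℂ) := by
    rw [integral_complex_ofReal, integral_unif hR, Complex.ofReal_one]
  have h2 : 1 - fourier (unif R) t
      = ∫ s : ℝ, (1 - Complex.exp (Complex.I * t * s)) * (unif R s : ℂ) := by
    rw [fourier]
    nth_rewrite 1 [h1]
    rw [← integral_sub (integrable_complex_ofReal (integrable_unif R))
      (integrable_exp_mul (integrable_complex_ofReal (integrable_unif R)) t)]
    congr 1
    ext s
    ring
  rw [h2]
  refine (norm_integral_le_integral_norm _).trans ?_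
  rw [← mul_one (R * |t|), ← integral_unif hR, ← integral_const_mul]
  refine integral_mono_of_nonneg (ae_of_all _ fun s => norm_nonneg _)
    ((integrable_unif R).const_mul _) (ae_of_all _ fun s => ?_)
  simp only
  rw [norm_mul, Complex.norm_real, Real.norm_eq_abs, abs_of_nonneg (unif_nonneg hR s)]
  by_cases hs : s ∈ Icc 0 R
  · refine mul_le_mul_of_nonneg_right ?_ (unif_nonneg hR s)
    have h3 := Real.norm_exp_I_mul_ofReal_sub_one_le (x := t * s)
    rw [norm_sub_rev] at h3
    have h4 : Complex.I * t * s = Complex.I * (t * s : ℝ) := by push_cast; ring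
    rw [h4]
    refine h3.trans ?_
    rw [Real.norm_eq_abs, abs_mul, abs_of_nonneg hs.1, mul_comm]
    exact mul_le_mul_of_nonneg_right hs.2 (abs_nonneg t)
  · simp [unif, hs]

/-- Translation by `s` moves the flat density `unif R` by `O(|s| / R)` in `L¹`. -/
theorem integral_abs_unif_sub_le {R : ℝ} (hR : 0 < R) (s : ℝ) :
    ∫ x, |unif R x - unif R (x - s)| ≤ min 2 (4 * |s| / R) := by
  have hi := integrable_unif R
  refine le_min ?_ ?_
  · have h1 : ∫ x, |unif R x - unif R (x - s)| ≤ ∫ x, (|unif R x| + |unif R (x - s)|) :=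
      integral_mono (hi.sub (hi.comp_sub_right s)).abs (hi.abs.add (hi.comp_sub_right s).abs)
        fun x => abs_sub _ _
    rw [integral_add hi.abs (hi.comp_sub_right s).abs, integral_abs_unif hR,
      integral_sub_right_eq_self (fun x => |unif R x|), integral_abs_unif hR] at h1
    linarith
  · -- the two indicators differ only within distance `|s|` of the endpoints
    set b : ℝ → ℝ := fun x => (Icc (-|s|) |s|).indicator (fun _ => R⁻¹) x
      + (Icc (R - |s|) (R + |s|)).indicator (fun _ => R⁻¹) x with hb
    have hb1 : Integrable ((Icc (-|s|) |s|).indicator fun _ : ℝ => R⁻¹) :=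
      (integrable_indicator_iff measurableSet_Icc).2 (integrableOn_const (by simp))
    have hb2 : Integrable ((Icc (R - |s|) (R + |s|)).indicator fun _ : ℝ => R⁻¹) :=
      (integrable_indicator_iff measurableSet_Icc).2 (integrableOn_const (by simp))
    have hR' := (inv_pos.2 hR).le
    have hle : ∀ x, |unif R x - unif R (x - s)| ≤ b x := by
      intro x
      have n1 : 0 ≤ (Icc (-|s|) |s|).indicator (fun _ : ℝ => R⁻¹) x :=
        indicator_nonneg (fun _ _ => hR') x
      have n2 : 0 ≤ (Icc (R - |s|) (R + |s|)).indicator (fun _ : ℝ => R⁻¹) x :=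
        indicator_nonneg (fun _ _ => hR') x
      have hs1 := le_abs_self s
      have hs2 := neg_abs_le s
      have hdiff : |unif R x - unif R (x - s)| ≤ R⁻¹ := by
        simp only [unif, indicator]
        split_ifs <;> simp [abs_of_nonneg hR', hR']
      by_cases h1 : x ∈ Icc (-|s|) |s|
      · have : b x = R⁻¹ + (Icc (R - |s|) (R + |s|)).indicator (fun _ => R⁻¹) x := by
          rw [hb]; simp only [indicator_of_mem h1]
        linarith
      by_cases h2 : x ∈ Icc (R - |s|) (R + |s|)
      · have : b x = (Icc (-|s|) |s|).indicator (fun _ => R⁻¹) x + R⁻¹ := by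
          rw [hb]; simp only [indicator_of_mem h2]
        linarith
      have h3 : x ∈ Icc 0 R ↔ x - s ∈ Icc 0 R := by
        simp only [mem_Icc, not_and_or, not_le] at h1 h2 ⊢
        constructor <;> rintro ⟨h4, h5⟩ <;> constructor <;> rcases h1 with h1 | h1 <;>
          rcases h2 with h2 | h2 <;> linarith
      have h4 : unif R x = unif R (x - s) := by
        simp only [unif, indicator, h3]
      rw [h4, sub_self, abs_zero]
      exact add_nonneg n1 n2
    refine (integral_mono (hi.sub (hi.comp_sub_right s)).abs (hb1.add hb2) hle).trans_eq ?_
    rw [integral_add' hb1 hb2, integral_indicator_const _ measurableSet_Icc,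
      integral_indicator_const _ measurableSet_Icc, Measure.real, Measure.real, Real.volume_Icc,
      Real.volume_Icc, ENNReal.toReal_ofReal (by linarith [abs_nonneg s]),
      ENNReal.toReal_ofReal (by linarith [abs_nonneg s]), smul_eq_mul, smul_eq_mul]
    field_simp
    ring

/-- Convolution with a probability density hardly changes a very flat density. -/
theorem exists_integral_abs_unif_sub_convolution_le (hg : Integrable g) (hg0 : ∀ x, 0 ≤ g x)
    (hg1 : ∫ x, g x = 1) :
    ∃ R > 0, ∫ x, |unif R x - (g ⋆ unif R) x| ≤ 1 / 2 := by
  have hbound : ∀ R > 0, ∫ x, |unif R x - (g ⋆ unif R) x| ≤ ∫ s, g s * min 2 (4 * |s| / R) := by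
    intro R hR
    have hi := integrable_unif R
    have i1 : Integrable (fun p : ℝ × ℝ => g p.2 * unif R p.1) (volume.prod volume) := by
      have := hi.mul_prod hg
      simpa only [mul_comm] using this
    have i2 : Integrable (fun p : ℝ × ℝ => g p.2 * unif R (p.1 - p.2)) (volume.prod volume) := by
      have := hg.convolution_integrand (ContinuousLinearMap.lsmul ℝ ℝ : ℝ →L[ℝ] ℝ →L[ℝ] ℝ) hi
      simpa using this
    have i3 : Integrable (fun p : ℝ × ℝ => g p.2 * |unif R p.1 - unif R (p.1 - p.2)|)
        (volume.prod volume) := by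
      refine (i1.sub i2).abs.congr (ae_of_all _ fun p => ?_)
      simp only [Pi.sub_apply]
      rw [← mul_sub, abs_mul, abs_of_nonneg (hg0 _)]
    have i4 := i3.integral_prod_left
    have hpt : ∀ᵐ x, |unif R x - (g ⋆ unif R) x|
        ≤ ∫ s, g s * |unif R x - unif R (x - s)| := by
      filter_upwards [i2.prod_right_ae] with x hx
      have h1 : unif R x - (g ⋆ unif R) x = ∫ s, g s * (unif R x - unif R (x - s)) := by
        simp only [mul_sub]
        rw [integral_sub (hg.mul_const _) hx, integral_mul_const, hg1, one_mul, convolution_def]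
        simp
      rw [h1]
      refine (abs_integral_le_integral_abs).trans_eq ?_
      congr 1
      ext s
      rw [abs_mul, abs_of_nonneg (hg0 s)]
    refine (integral_mono_ae (hi.sub (hg.integrable_convolution _ hi)).abs i4 hpt).trans ?_
    rw [integral_integral_swap i3]
    refine integral_mono i3.integral_prod_right ?_ fun s => ?_
    · refine hg.mul_bdd (c := 2) (Measurable.aestronglyMeasurable (by fun_prop))
        (ae_of_all _ fun s => ?_)
      rw [Real.norm_eq_abs, abs_of_nonneg (by positivity)]
      exact min_le_left _ _
    · simp only
      rw [integral_const_mul]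
      exact mul_le_mul_of_nonneg_left (integral_abs_unif_sub_le hR s) (hg0 s)
  have hlim : Tendsto (fun R : ℝ => ∫ s, g s * min 2 (4 * |s| / R)) atTop
      (𝓝 (∫ s, g s * min 2 0)) := by
    refine tendsto_integral_filter_of_dominated_convergence (fun s => g s * 2) ?_ ?_
      (hg.mul_const 2) ?_
    · exact Eventually.of_forall fun R => hg.aestronglyMeasurable.mul
        (Measurable.aestronglyMeasurable (by fun_prop))
    · filter_upwards [eventually_gt_atTop 0] with R hR
      refine ae_of_all _ fun s => ?_
      rw [Real.norm_eq_abs, abs_mul, abs_of_nonneg (hg0 s), abs_of_nonneg (by positivity)]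
      exact mul_le_mul_of_nonneg_left (min_le_left _ _) (hg0 s)
    · exact ae_of_all _ fun s => (tendsto_const_nhds.min
        (tendsto_const_nhds.div_atTop tendsto_id)).const_mul _
  have h0 : ∫ s, g s * min 2 (0 : ℝ) = 0 := by simp
  rw [h0] at hlim
  obtain ⟨R, hR, hR'⟩ := ((eventually_gt_atTop 0).and
    (hlim.eventually (Iio_mem_nhds (show (0 : ℝ) < 1 / 2 by norm_num)))).exists
  exact ⟨R, hR, (hbound R hR).trans (le_of_lt hR')⟩

/-- The Neumann series: if `‖r‖₁ ≤ 1 / 2`, the equation `G - r ⋆ G = W` has a solution in `L¹`. -/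
theorem exists_fourier_mul_one_sub_eq (hr : Integrable r) (hr' : ∫ x, |r x| ≤ 1 / 2)
    (hW : Integrable W) :
    ∃ G : ℝ → ℝ, Integrable G ∧ ∀ t, fourier G t * (1 - fourier r t) = fourier W t := by
  -- the `k`-th term of the series, the `k`-fold convolution of `r` applied to `W`
  set q : ℕ → ℝ → ℝ := fun k => Nat.rec W (fun _ p => r ⋆ p) k with hq
  have hq0 : q 0 = W := rfl
  have hqs : ∀ k, q (k + 1) = r ⋆ q k := fun k => rfl
  have hint : ∀ k, Integrable (q k) := by
    intro k
    induction k with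
    | zero => exact hW
    | succ k ih => rw [hqs]; exact hr.integrable_convolution _ ih
  have hnorm : ∀ k, ∫ x, |q k x| ≤ (1 / 2) ^ k * ∫ x, |W x| := by
    intro k
    induction k with
    | zero => simp [hq0]
    | succ k ih =>
      rw [hqs]
      refine (integral_abs_convolution_le hr (hint k)).trans ?_
      have : 0 ≤ ∫ x, |q k x| := integral_nonneg fun x => abs_nonneg _
      calc (∫ x, |r x|) * ∫ x, |q k x| ≤ 1 / 2 * ((1 / 2) ^ k * ∫ x, |W x|) := by gcongr
        _ = _ := by ring
  have hfour : ∀ k t, fourier (q k) t = fourier r t ^ k * fourier W t := by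
    intro k t
    induction k with
    | zero => simp [hq0]
    | succ k ih => rw [hqs, fourier_convolution hr (hint k), ih]; ring
  have hsum : Summable fun k => ∫ x, |q k x| :=
    Summable.of_nonneg_of_le (fun k => integral_nonneg fun x => abs_nonneg _) hnorm
      ((summable_geometric_of_lt_one (by norm_num) (by norm_num)).mul_right _)
  refine ⟨fun x => ∑' k, q k x, ?_, fun t => ?_⟩
  · have hlint : ∫⁻ x, ∑' k, ‖q k x‖ₑ ≠ ∞ := by
      rw [lintegral_tsum fun k => (hint k).aestronglyMeasurable.enorm]
      have h1 : ∀ k, ∫⁻ x, ‖q k x‖ₑ = ENNReal.ofReal (∫ x, |q k x|) := fun k =>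
        (ofReal_integral_norm_eq_lintegral_enorm (hint k)).symm
      simp only [h1]
      rw [← ENNReal.ofReal_tsum_of_nonneg (fun k => integral_nonneg fun x => abs_nonneg _) hsum]
      exact ENNReal.ofReal_ne_top
    have hmeas : AEMeasurable (fun x => ∑' k, ‖q k x‖ₑ) :=
      AEMeasurable.tsum fun k => (hint k).aestronglyMeasurable.enorm
    have hae : ∀ᵐ x, Summable fun k => q k x := by
      filter_upwards [ae_lt_top' hmeas hlint] with x hx
      have h1 : Summable fun k => ‖q k x‖₊ := ENNReal.tsum_coe_ne_top_iff_summable.1 hx.ne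
      exact Summable.of_nnnorm h1
    refine ⟨aestronglyMeasurable_of_tendsto_ae atTop
      (f := fun n x => ∑ k ∈ Finset.range n, q k x)
      (fun n => (integrable_finsetSum _ fun k _ => hint k).aestronglyMeasurable) ?_, ?_⟩
    · filter_upwards [hae] with x hx using hx.hasSum.tendsto_sum_nat
    · exact (lintegral_mono fun x => enorm_tsum_le_tsum_enorm).trans_lt hlint.lt_top
  · have h1 := hasSum_integral_of_summable_integral_norm (μ := volume)
      (F := fun k (s : ℝ) => Complex.exp (Complex.I * t * s) * (q k s : ℂ))
      (fun k => integrable_exp_mul (integrable_complex_ofReal (hint k)) t) (by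
        refine hsum.congr fun k => ?_
        congr 1
        ext s
        rw [norm_mul, norm_exp_I_mul_mul, one_mul, Complex.norm_real, Real.norm_eq_abs])
    have h2 : (∫ s : ℝ, ∑' k, Complex.exp (Complex.I * t * s) * (q k s : ℂ))
        = fourier (fun x => ∑' k, q k x) t := by
      rw [fourier]
      congr 1
      ext s
      rw [tsum_mul_left, Complex.ofReal_tsum]
    rw [h2] at h1
    have hlt : ‖fourier r t‖ < 1 := ((norm_fourier_le r t).trans hr').trans_lt (by norm_num)
    have h3 := (hasSum_geometric_of_norm_lt_one hlt).mul_right (fourier W t)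
    have h4 := h1.unique (h3.congr_fun fun k => (hfour k t))
    have h5 : 1 - fourier r t ≠ 0 := by
      intro h
      rw [← sub_eq_zero.1 h] at hlt
      simp at hlt
    rw [h4]
    field_simp

/-- A local form of Wiener's lemma: `1 / fourier g` agrees near the origin, up to an error of first
order, with the Fourier transform of an integrable function. With a flat density `W = unif R` and
`r = W - g ⋆ W`, small in `L¹`, the Neumann series gives a function `G` for which
`1 - fourier G * fourier g = (1 - fourier W) / (1 - fourier r)`; only `W` needs a first moment, so
none of `g` has to exist. -/
theorem exists_norm_one_sub_fourier_mul_le (hg : Integrable g) (hg0 : ∀ x, 0 ≤ g x)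
    (hg1 : ∫ x, g x = 1) :
    ∃ G : ℝ → ℝ, Integrable G ∧ ∃ c, 0 ≤ c ∧ ∀ t, ‖1 - fourier G t * fourier g t‖ ≤ c * |t| := by
  obtain ⟨R, hR, hR'⟩ := exists_integral_abs_unif_sub_convolution_le hg hg0 hg1
  have hi := integrable_unif R
  have hc := hg.integrable_convolution (ContinuousLinearMap.lsmul ℝ ℝ) hi
  obtain ⟨G, hG, hG'⟩ := exists_fourier_mul_one_sub_eq (r := fun x => unif R x - (g ⋆ unif R) x)
    (hi.sub hc) hR' hi
  refine ⟨G, hG, 2 * R, by positivity, fun t => ?_⟩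
  set w := fourier (unif R) t
  set r := fourier (fun x => unif R x - (g ⋆ unif R) x) t with hr
  have h1 : r = w - fourier g t * w := by
    rw [← fourier_convolution hg hi, hr]
    simp only [fourier, w]
    rw [← integral_sub (integrable_exp_mul (integrable_complex_ofReal hi) t)
      (integrable_exp_mul (integrable_complex_ofReal hc) t)]
    congr 1
    ext s
    push_cast
    ring
  have h2 : (1 - fourier G t * fourier g t) * (1 - r) = 1 - w := by
    have := hG' t
    linear_combination -(fourier g t) * this - h1
  have h3 : 1 / 2 ≤ ‖1 - r‖ := by
    have := (norm_fourier_le _ t).trans hR'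
    have h4 := norm_sub_norm_le (1 : ℂ) r
    rw [norm_one] at h4
    linarith
  have h5 := norm_one_sub_fourier_unif_le hR t
  rw [← h2, norm_mul] at h5
  have h6 := norm_nonneg (1 - fourier G t * fourier g t)
  nlinarith

end LocalInverse

/-! ### Empirical measures -/

section Empirical

open scoped NNReal

/-- The empirical measure of the first `n` terms of `y`; it is `0` for `n = 0`. -/
noncomputable def empMeas (n : ℕ) (y : ℕ → ℝ) : Measure ℝ :=
  (n : ℝ≥0)⁻¹ • ∑ i ∈ Finset.range n, Measure.dirac (y i)

instance (n : ℕ) (y : ℕ → ℝ) : IsFiniteMeasure (empMeas n y) := by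
  unfold empMeas
  infer_instance

theorem integral_empMeas {E : Type*} [NormedAddCommGroup E] [NormedSpace ℝ E] [CompleteSpace E]
    (n : ℕ) (y : ℕ → ℝ) (g : ℝ → E) :
    ∫ x, g x ∂empMeas n y = (n : ℝ)⁻¹ • ∑ i ∈ Finset.range n, g (y i) := by
  rw [empMeas, integral_smul_nnreal_measure, integral_finsetSum_measure
    fun i _ => (integrable_dirac (by simp))]
  simp only [integral_dirac]
  rw [NNReal.smul_def]
  simp

theorem charFun_empMeas (n : ℕ) (y : ℕ → ℝ) (t : ℝ) : charFun (empMeas n y) t = empChar n y t := by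
  rw [charFun_apply_real, integral_empMeas, empChar, Complex.real_smul]
  push_cast
  congr 1
  refine Finset.sum_congr rfl fun i _ => ?_
  congr 1
  ring

theorem real_empMeas (n : ℕ) (y : ℕ → ℝ) {s : Set ℝ} (hs : MeasurableSet s) :
    (empMeas n y).real s
      = (n : ℝ)⁻¹ * ∑ i ∈ Finset.range n, s.indicator (fun _ => (1 : ℝ)) (y i) := by
  have := integral_empMeas n y (s.indicator fun _ => (1 : ℝ))
  rwa [integral_indicator_const _ hs, smul_eq_mul, mul_one, smul_eq_mul] at this

theorem real_empMeas_le_one (n : ℕ) (y : ℕ → ℝ) (s : Set ℝ) : (empMeas n y).real s ≤ 1 := by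
  refine (measureReal_mono (subset_univ _)).trans ?_
  rw [real_empMeas n y MeasurableSet.univ]
  simp only [indicator_univ, Finset.sum_const, Finset.card_range, nsmul_eq_mul, mul_one]
  exact inv_mul_le_one

theorem norm_empChar_le (n : ℕ) (y : ℕ → ℝ) (t : ℝ) : ‖empChar n y t‖ ≤ 1 := by
  rw [← charFun_empMeas]
  exact (norm_charFun_le t).trans (real_empMeas_le_one n y _)

variable {Ω : Type*} [MeasurableSpace Ω] {μ : Measure Ω} [IsProbabilityMeasure μ]

/-- Markov's inequality for convergence in probability. -/
theorem tendsto_measure_ge_of_integral_le {Z : ℕ → Ω → ℝ} {b : ℕ → ℝ}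
    (h : ∀ᶠ n in atTop, 0 ≤ Z n ∧ Integrable (Z n) μ ∧ ∫ ω, Z n ω ∂μ ≤ b n)
    (hb : Tendsto b atTop (𝓝 0)) {δ : ℝ} (hδ : 0 < δ) :
    Tendsto (fun n => μ {ω | δ ≤ Z n ω}) atTop (𝓝 0) := by
  have h1 : Tendsto (fun n => ENNReal.ofReal (b n / δ)) atTop (𝓝 0) := by
    have := (ENNReal.continuous_ofReal.tendsto _).comp (hb.div_const δ)
    rwa [zero_div, ENNReal.ofReal_zero] at this
  refine tendsto_of_tendsto_of_tendsto_of_le_of_le' tendsto_const_nhds h1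
    (Eventually.of_forall fun n => zero_le) ?_
  filter_upwards [h] with n hn
  have h2 := mul_meas_ge_le_integral_of_nonneg (ae_of_all μ hn.1) hn.2.1 δ
  rw [← ofReal_measureReal]
  refine ENNReal.ofReal_le_ofReal ?_
  rw [le_div_iff₀ hδ, mul_comm]
  exact h2.trans hn.2.2

variable {Y : ℕ → Ω → ℝ} {P : Measure ℝ}

/-- The weak law of large numbers in `L¹`, with its rate, for bounded functions of a sample. -/
theorem integral_abs_empMeas_sub_le (hY : ∀ i, Measurable (Y i)) (hind : iIndepFun Y μ)
    (hlaw : ∀ i, μ.map (Y i) = P) {g : ℝ → ℝ} (hg : Measurable g) (hg1 : ∀ x, |g x| ≤ 1)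
    {n : ℕ} (hn : 0 < n) :
    Integrable (fun ω => |(∫ x, g x ∂empMeas n fun i => Y i ω) - ∫ x, g x ∂P|) μ ∧
    ∫ ω, |(∫ x, g x ∂empMeas n fun i => Y i ω) - ∫ x, g x ∂P| ∂μ ≤ 1 / √n := by
  simp only [integral_empMeas, smul_eq_mul]
  have hnR : (0 : ℝ) < n := by exact_mod_cast hn
  set m := ∫ x, g x ∂P with hm
  have hmeas : ∀ i, Measurable fun ω => g (Y i ω) := fun i => hg.comp (hY i)
  have hL : ∀ i, MemLp (fun ω => g (Y i ω)) 2 μ := fun i =>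
    MemLp.of_bound (hmeas i).aestronglyMeasurable 1 (ae_of_all _ fun ω => hg1 _)
  set S : Ω → ℝ := ∑ i ∈ Finset.range n, fun ω => g (Y i ω) with hS
  have hSapp : ∀ ω, S ω = ∑ i ∈ Finset.range n, g (Y i ω) := fun ω => by
    rw [hS, Finset.sum_apply]
  have hSL : MemLp S 2 μ := memLp_finsetSum' _ fun i _ => hL i
  set Z : Ω → ℝ := fun ω => (n : ℝ)⁻¹ * S ω with hZ
  have hZL : MemLp Z 2 μ := hSL.const_mul _
  have hmean : ∫ ω, Z ω ∂μ = m := by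
    rw [hZ, integral_const_mul]
    simp only [hSapp]
    rw [integral_finsetSum _ fun i _ => (hL i).integrable (by norm_num)]
    have h1 : ∀ i ∈ Finset.range n, ∫ ω, g (Y i ω) ∂μ = m := fun i _ => by
      rw [hm, ← hlaw i, integral_map (hY i).aemeasurable hg.aestronglyMeasurable]
    rw [Finset.sum_congr rfl h1, Finset.sum_const, Finset.card_range, nsmul_eq_mul,
      inv_mul_cancel_left₀ hnR.ne']
  have hvar : variance Z μ ≤ 1 / (n : ℝ) := by
    rw [hZ, variance_const_mul, hS, IndepFun.variance_sum (fun i _ => hL i)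
      fun i _ j _ hij => (hind.indepFun hij).comp hg hg]
    have h1 : ∀ i ∈ Finset.range n, variance (fun ω => g (Y i ω)) μ ≤ 1 := fun i _ => by
      have := variance_le_sq_of_bounded (μ := μ) (X := fun ω => g (Y i ω)) (a := -1) (b := 1)
        (ae_of_all _ fun ω => abs_le.1 (hg1 _)) (hmeas i).aemeasurable
      norm_num at this
      exact this
    have h2 := Finset.sum_le_sum h1
    rw [Finset.sum_const, Finset.card_range, nsmul_eq_mul, mul_one] at h2
    calc (n : ℝ)⁻¹ ^ 2 * _ ≤ (n : ℝ)⁻¹ ^ 2 * (n : ℝ) := by gcongr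
      _ = 1 / (n : ℝ) := by field_simp
  have hsub : MemLp (fun ω => |Z ω - m|) 2 μ := (hZL.sub (memLp_const m)).abs
  have hkey : ∀ ω, |(n : ℝ)⁻¹ * ∑ i ∈ Finset.range n, g (Y i ω) - m| = |Z ω - m| := fun ω => by
    rw [hZ, ← hSapp]
  simp only [hkey]
  refine ⟨hsub.integrable (by norm_num), ?_⟩
  -- the square of the mean is at most the mean of the square
  have h1 := variance_nonneg (fun ω => |Z ω - m|) μ
  rw [variance_eq_sub hsub] at h1
  rw [variance_eq_integral hZL.aemeasurable, hmean] at hvar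
  have h2 : (μ[(fun ω => |Z ω - m|) ^ 2]) = ∫ ω, (Z ω - m) ^ 2 ∂μ := by
    congr 1
    ext ω
    simp
  rw [h2] at h1
  have h3 : (1 / √n) ^ 2 = 1 / (n : ℝ) := by
    rw [div_pow, one_pow, Real.sq_sqrt hnR.le]
  refine (pow_le_pow_iff_left₀ (integral_nonneg fun ω => abs_nonneg _) (by positivity)
    two_ne_zero).1 ?_
  rw [h3]
  linarith

variable [IsProbabilityMeasure P]

theorem tendsto_one_div_sqrt_atTop : Tendsto (fun n : ℕ => 1 / √(n : ℝ)) atTop (𝓝 0) :=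
  tendsto_const_nhds.div_atTop (Real.tendsto_sqrt_atTop.comp tendsto_natCast_atTop_atTop)

theorem continuous_cdf (P : Measure ℝ) [IsProbabilityMeasure P] (h0 : ∀ x, P {x} = 0) :
    Continuous (cdf P) := by
  rw [continuous_iff_continuousAt]
  intro x
  rw [(monotone_cdf P).continuousAt_iff_leftLim_eq_rightLim, (cdf P).rightLim_eq]
  have h1 := (cdf P).measure_singleton x
  rw [measure_cdf, h0, eq_comm, ENNReal.ofReal_eq_zero] at h1
  exact le_antisymm ((monotone_cdf P).leftLim_le le_rfl) (by linarith)

/-- The Glivenko–Cantelli theorem, in probability, for a continuous distribution function. -/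
theorem tendsto_measure_empMeas_Iic (hY : ∀ i, Measurable (Y i)) (hind : iIndepFun Y μ)
    (hlaw : ∀ i, μ.map (Y i) = P) (h0 : ∀ x, P {x} = 0) {η : ℝ} (hη : 0 < η) :
    Tendsto (fun n =>
      μ {ω | ¬ ∀ s, |(empMeas n fun i => Y i ω).real (Iic s) - P.real (Iic s)| ≤ η})
      atTop (𝓝 0) := by
  obtain ⟨m, hm⟩ := exists_nat_gt (2 / η)
  have hmR : (0 : ℝ) < m := (by positivity : (0 : ℝ) < 2 / η).trans hm
  have hm1 : 1 / (m : ℝ) ≤ η / 2 := by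
    rw [div_lt_iff₀ hη] at hm
    rw [div_le_div_iff₀ hmR two_pos]
    linarith
  -- a grid of quantiles
  have hgrid : ∀ j ∈ Finset.Ioo 0 m, ∃ x, P.real (Iic x) = j / m := by
    intro j hj
    rw [Finset.mem_Ioo] at hj
    have h1 : (0 : ℝ) < j / m := div_pos (by exact_mod_cast hj.1) hmR
    have h2 : (j : ℝ) / m < 1 := (div_lt_one hmR).2 (by exact_mod_cast hj.2)
    obtain ⟨x, hx⟩ := mem_range_of_exists_le_of_exists_ge (continuous_cdf P h0)
      (((tendsto_cdf_atBot P).eventually (Iio_mem_nhds h1)).exists.imp fun _ h => le_of_lt h)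
      (((tendsto_cdf_atTop P).eventually (Ioi_mem_nhds h2)).exists.imp fun _ h => le_of_lt h)
    exact ⟨x, by rw [← cdf_eq_real, hx]⟩
  choose! q hq using hgrid
  have hpt : ∀ j, Tendsto (fun n => μ {ω | η / 2 ≤
      |(empMeas n fun i => Y i ω).real (Iic (q j)) - P.real (Iic (q j))|}) atTop (𝓝 0) := by
    intro j
    refine tendsto_measure_ge_of_integral_le ?_ tendsto_one_div_sqrt_atTop (half_pos hη)
    filter_upwards [eventually_gt_atTop 0] with n hn
    have := integral_abs_empMeas_sub_le hY hind hlaw (g := (Iic (q j)).indicator fun _ => (1 : ℝ))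
      (measurable_const.indicator measurableSet_Iic)
      (fun x => by by_cases hx : x ∈ Iic (q j) <;> simp [indicator, hx]) hn
    simp only [integral_indicator_const _ (measurableSet_Iic (a := q j)), smul_eq_mul,
      mul_one] at this
    exact ⟨fun ω => abs_nonneg _, this.1, this.2⟩
  have hsum := tendsto_finsetSum (Finset.Ioo 0 m) fun j _ => hpt j
  rw [Finset.sum_const_zero] at hsum
  refine tendsto_of_tendsto_of_tendsto_of_le_of_le tendsto_const_nhds hsum (fun n => zero_le)
    fun n => ?_
  refine (measure_mono fun ω hω => ?_).trans (measure_biUnion_finset_le _ _)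
  by_contra hcon
  simp only [mem_iUnion, mem_ofPred_eq, not_exists, not_le] at hcon
  refine hω fun s => ?_
  set Q := empMeas n fun i => Y i ω
  set v := P.real (Iic s)
  have hv0 : 0 ≤ v := measureReal_nonneg
  have hv1 : v ≤ 1 := measureReal_le_one
  have hQ1 : Q.real (Iic s) ≤ 1 := real_empMeas_le_one _ _ _
  have hQ0 : 0 ≤ Q.real (Iic s) := measureReal_nonneg
  have hmono : ∀ {a b : ℝ} (R : Measure ℝ) [IsFiniteMeasure R], a ≤ b →
      R.real (Iic a) ≤ R.real (Iic b) := fun R _ hab => measureReal_mono (Iic_subset_Iic.2 hab)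
  have hm2 : (m : ℝ) * (1 / m) = 1 := by field_simp
  -- both distribution functions are monotone, so closeness at the grid point next to `s`, on its left
  -- for the lower bound and on its right for the upper one, costs only the mesh `1 / m`
  refine abs_le.2 ⟨?_, ?_⟩
  · rcases le_or_gt v (1 / (m : ℝ)) with hv | hv
    · linarith
    have hvm : 1 < v * m := by rwa [div_lt_iff₀ hmR] at hv
    have hceil : 1 < ⌈v * m⌉₊ := Nat.lt_ceil.2 (by exact_mod_cast hvm)
    have hlt : ((⌈v * m⌉₊ - 1 : ℕ) : ℝ) < v * m := by
      have := Nat.ceil_lt_add_one (mul_nonneg hv0 hmR.le)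
      rw [Nat.cast_sub hceil.le]
      push_cast
      linarith
    have hle : v * m ≤ ((⌈v * m⌉₊ - 1 : ℕ) : ℝ) + 1 := by
      rw [Nat.cast_sub hceil.le]
      push_cast
      linarith [Nat.le_ceil (v * m)]
    set j := ⌈v * m⌉₊ - 1
    have hj : j ∈ Finset.Ioo 0 m := by
      rw [Finset.mem_Ioo]
      refine ⟨by omega, ?_⟩
      have : (j : ℝ) < m := hlt.trans_le (by nlinarith)
      exact_mod_cast this
    have hqs : q j ≤ s := by
      by_contra! hcon'
      have h1 := hmono P hcon'.le
      rw [hq j hj, le_div_iff₀ hmR] at h1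
      change v * m ≤ j at h1
      linarith
    have h1 := (abs_lt.1 (hcon j hj)).1
    have h2 := hmono Q hqs
    rw [hq j hj] at h1
    have h3 : v ≤ j / m + 1 / m := by
      rw [← add_div, le_div_iff₀ hmR]
      exact hle
    linarith
  · rcases le_or_gt (1 - 1 / (m : ℝ)) v with hv | hv
    · linarith
    have hvm : v * m < m - 1 := by nlinarith
    have hlt : v * m < ((⌊v * m⌋₊ + 1 : ℕ) : ℝ) := by
      push_cast
      exact Nat.lt_floor_add_one _
    have hle : ((⌊v * m⌋₊ + 1 : ℕ) : ℝ) ≤ v * m + 1 := by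
      push_cast
      linarith [Nat.floor_le (mul_nonneg hv0 hmR.le)]
    have hj0 : 0 < ⌊v * m⌋₊ + 1 := Nat.succ_pos _
    set j := ⌊v * m⌋₊ + 1
    have hj : j ∈ Finset.Ioo 0 m := by
      rw [Finset.mem_Ioo]
      refine ⟨hj0, ?_⟩
      have : (j : ℝ) < m := by linarith
      exact_mod_cast this
    have hqs : s ≤ q j := by
      by_contra! hcon'
      have h1 := hmono P hcon'.le
      rw [hq j hj, div_le_iff₀ hmR] at h1
      change (j : ℝ) ≤ v * m at h1
      linarith
    have h1 := (abs_lt.1 (hcon j hj)).2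
    have h2 := hmono Q hqs
    rw [hq j hj] at h1
    have h3 : j / m ≤ v + 1 / m := by
      rw [div_le_iff₀ hmR, add_mul, one_div, inv_mul_cancel₀ hmR.ne']
      exact hle
    linarith

/-- The law of large numbers for `cos` and `sin`, the real and imaginary parts of the characteristic
function. -/
theorem integral_norm_empChar_sub_le (hY : ∀ i, Measurable (Y i)) (hind : iIndepFun Y μ)
    (hlaw : ∀ i, μ.map (Y i) = P) {n : ℕ} (hn : 0 < n) (t : ℝ) :
    ∫ ω, ‖empChar n (fun i => Y i ω) t - charFun P t‖ ∂μ ≤ 2 / √n := by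
  have hc := integral_abs_empMeas_sub_le hY hind hlaw (g := fun x => Real.cos (t * x))
    (by fun_prop) (fun x => Real.abs_cos_le_one _) hn
  have hs := integral_abs_empMeas_sub_le hY hind hlaw (g := fun x => Real.sin (t * x))
    (by fun_prop) (fun x => Real.abs_sin_le_one _) hn
  have hre : ∀ (Q : Measure ℝ) [IsFiniteMeasure Q], (charFun Q t).re = ∫ x, Real.cos (t * x) ∂Q ∧
      (charFun Q t).im = ∫ x, Real.sin (t * x) ∂Q := by
    intro Q _
    have hint : Integrable (fun x : ℝ => Complex.exp (t * x * Complex.I)) Q := by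
      refine Integrable.of_bound (C := 1) (Continuous.aestronglyMeasurable (by fun_prop))
        (ae_of_all _ fun x => ?_)
      have := Complex.norm_exp_ofReal_mul_I (t * x)
      push_cast at this
      exact this.le
    rw [charFun_apply_real]
    have h1 : ∀ x : ℝ, (Complex.exp (t * x * Complex.I)).re = Real.cos (t * x) := fun x => by
      rw [← Complex.ofReal_mul, Complex.exp_ofReal_mul_I_re]
    have h2 : ∀ x : ℝ, (Complex.exp (t * x * Complex.I)).im = Real.sin (t * x) := fun x => by
      rw [← Complex.ofReal_mul, Complex.exp_ofReal_mul_I_im]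
    constructor
    · have := integral_re hint
      simp only [RCLike.re_eq_complex_re, h1] at this
      exact this.symm
    · have := integral_im hint
      simp only [RCLike.im_eq_complex_im, h2] at this
      exact this.symm
  have hle : ∫ ω, ‖empChar n (fun i => Y i ω) t - charFun P t‖ ∂μ ≤
      ∫ ω, (|(∫ x, Real.cos (t * x) ∂empMeas n fun i => Y i ω) - ∫ x, Real.cos (t * x) ∂P|
        + |(∫ x, Real.sin (t * x) ∂empMeas n fun i => Y i ω) - ∫ x, Real.sin (t * x) ∂P|) ∂μ := by
    refine integral_mono_of_nonneg (ae_of_all _ fun ω => norm_nonneg _) (hc.1.add hs.1)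
      (ae_of_all _ fun ω => ?_)
    simp only
    rw [← charFun_empMeas]
    refine (Complex.norm_le_abs_re_add_abs_im _).trans_eq ?_
    rw [Complex.sub_re, Complex.sub_im, (hre _).1, (hre _).2, (hre P).1, (hre P).2]
  rw [integral_add hc.1 hs.1] at hle
  refine hle.trans ((add_le_add hc.2 hs.2).trans_eq ?_)
  ring

theorem measurable_uncurry_empChar (hY : ∀ i, Measurable (Y i)) (n : ℕ) :
    Measurable fun p : Ω × ℝ => empChar n (fun i => Y i p.1) p.2 := by
  unfold empChar
  fun_prop

/-- The mean `L¹` deviation of the empirical characteristic function over an interval. -/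
theorem integral_integral_norm_empChar_sub_le (hY : ∀ i, Measurable (Y i)) (hind : iIndepFun Y μ)
    (hlaw : ∀ i, μ.map (Y i) = P) {n : ℕ} (hn : 0 < n) {T : ℝ} (hT : 0 ≤ T) :
    Integrable (fun ω => ∫ t in Icc (-T) T, ‖empChar n (fun i => Y i ω) t - charFun P t‖) μ ∧
    ∫ ω, (∫ t in Icc (-T) T, ‖empChar n (fun i => Y i ω) t - charFun P t‖) ∂μ ≤ 4 * T / √n := by
  have hint : Integrable (fun p : Ω × ℝ => ‖empChar n (fun i => Y i p.1) p.2 - charFun P p.2‖)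
      (μ.prod (volume.restrict (Icc (-T) T))) := by
    refine Integrable.of_bound (C := 2) ?_ (ae_of_all _ fun p => ?_)
    · exact (((measurable_uncurry_empChar hY n).sub
        ((continuous_charFun P).measurable.comp measurable_snd)).norm).aestronglyMeasurable
    · rw [norm_norm]
      refine (norm_sub_le _ _).trans ?_
      linarith [norm_empChar_le n (fun i => Y i p.1) p.2, norm_charFun_le_one (μ := P) p.2]
  refine ⟨hint.integral_prod_left, ?_⟩
  rw [integral_integral_swap hint]
  have h1 : ∫ t in Icc (-T) T, (∫ ω, ‖empChar n (fun i => Y i ω) t - charFun P t‖ ∂μ)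
      ≤ ∫ t in Icc (-T) T, 2 / √n :=
    integral_mono hint.integral_prod_right (integrable_const _)
      fun t => integral_norm_empChar_sub_le hY hind hlaw hn t
  refine h1.trans_eq ?_
  rw [setIntegral_const, Measure.real, Real.volume_Icc, ENNReal.toReal_ofReal (by linarith),
    smul_eq_mul]
  ring

end Empirical

/-! ### The estimator and its bias -/

section Estimator

open scoped Convolution

variable {K f fε G : ℝ → ℝ} {h c : ℝ} {ψ ν : ℝ → ℂ}

theorem fourier_scaled_eq_zero (hKsupp : ∀ t : ℝ, 1 < |t| → fourier K t = 0) (hh : 0 < h) {t : ℝ}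
    (ht : t ∉ Icc (-h⁻¹) h⁻¹) : fourier (scaled K h) t = 0 := by
  rw [fourier_scaled K hh]
  refine hKsupp _ ?_
  rw [mem_Icc, ← abs_le, not_le] at ht
  rw [abs_mul, abs_of_pos hh]
  rwa [inv_eq_one_div, div_lt_iff₀' hh] at ht

theorem integrable_fourier_scaled_mul (hK : Integrable K)
    (hKsupp : ∀ t : ℝ, 1 < |t| → fourier K t = 0) (hh : 0 < h) (hψ : Continuous ψ) :
    Integrable fun t => fourier (scaled K h) t * ψ t := by
  refine Continuous.integrable_of_hasCompactSupport
    ((continuous_fourier (integrable_scaled hK hh)).mul hψ) ?_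
  refine HasCompactSupport.intro (isCompact_Icc (a := -h⁻¹) (b := h⁻¹)) fun t ht => ?_
  rw [fourier_scaled_eq_zero hKsupp hh ht, zero_mul]

theorem continuous_empChar (n : ℕ) (y : ℕ → ℝ) : Continuous (empChar n y) := by
  unfold empChar
  fun_prop

theorem integrable_estimator (hK : Integrable K)
    (hKsupp : ∀ t : ℝ, 1 < |t| → fourier K t = 0) (hfε : Integrable fε)
    (hne : ∀ t, fourier fε t ≠ 0) (hh : 0 < h) (hν : Continuous ν) :
    Integrable fun t => fourier (scaled K h) t * ν t / fourier fε t := by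
  have := integrable_fourier_scaled_mul hK hKsupp hh
    (hν.div (continuous_fourier hfε) hne)
  refine this.congr (ae_of_all _ fun t => ?_)
  simp only [Pi.div_apply]
  ring

/-- The high-frequency part of an estimator, divided by `I t`. If `fourier G` inverts `fourier fε` up
to an error `c |t|`, the division is harmless near the origin; at `t = 0` it has the value `0` by the
convention on division, and multiplying by `I t` gives back the right value there, which is `0`. -/
noncomputable def highPart (K fε G : ℝ → ℝ) (h : ℝ) (ν : ℝ → ℂ) (t : ℝ) : ℂ :=
  fourier (scaled K h) t * ν t / fourier fε t *
    ((1 - fourier G t * fourier fε t) / (Complex.I * t))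

theorem norm_highPart_le (hc0 : 0 ≤ c)
    (hc : ∀ t, ‖1 - fourier G t * fourier fε t‖ ≤ c * |t|) (t : ℝ) :
    ‖highPart K fε G h ν t‖ ≤ c * ‖fourier (scaled K h) t * ν t / fourier fε t‖ := by
  rw [highPart, norm_mul, mul_comm]
  refine mul_le_mul_of_nonneg_right ?_ (norm_nonneg _)
  rw [norm_div, norm_mul, Complex.norm_I, one_mul, Complex.norm_real, Real.norm_eq_abs]
  exact div_le_of_le_mul₀ (abs_nonneg t) hc0 (hc t)

theorem I_mul_mul_highPart (hc : ∀ t, ‖1 - fourier G t * fourier fε t‖ ≤ c * |t|)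
    (hne : ∀ t, fourier fε t ≠ 0) (t : ℝ) :
    Complex.I * t * highPart K fε G h ν t = fourier (scaled K h) t * ν t / fourier fε t
      - fourier (scaled K h) t * fourier G t * ν t := by
  have h1 : Complex.I * t * ((1 - fourier G t * fourier fε t) / (Complex.I * t))
      = 1 - fourier G t * fourier fε t := by
    rcases eq_or_ne t 0 with rfl | ht
    · have := hc 0
      rw [abs_zero, mul_zero, norm_le_zero_iff] at this
      rw [this]
      simp
    · rw [mul_div_cancel₀]
      simpa using ht
  rw [highPart, mul_left_comm, h1]
  have := hne t
  field_simp

theorem integrable_highPart (hK : Integrable K) (hKsupp : ∀ t : ℝ, 1 < |t| → fourier K t = 0)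
    (hfε : Integrable fε) (hne : ∀ t, fourier fε t ≠ 0) (hG : Integrable G) (hc0 : 0 ≤ c)
    (hc : ∀ t, ‖1 - fourier G t * fourier fε t‖ ≤ c * |t|) (hh : 0 < h) (hν : Continuous ν) :
    Integrable (highPart K fε G h ν) := by
  have h1 := integrable_estimator hK hKsupp hfε hne hh hν
  refine (h1.norm.const_mul c).mono' ?_ (ae_of_all _ fun t => norm_highPart_le hc0 hc t)
  refine h1.aestronglyMeasurable.mul (Measurable.aestronglyMeasurable ?_)
  have h2 := (continuous_fourier hG).measurable
  have h3 := (continuous_fourier hfε).measurable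
  fun_prop

theorem integrable_I_mul_mul_highPart (hK : Integrable K)
    (hKsupp : ∀ t : ℝ, 1 < |t| → fourier K t = 0)
    (hfε : Integrable fε) (hne : ∀ t, fourier fε t ≠ 0) (hG : Integrable G)
    (hc : ∀ t, ‖1 - fourier G t * fourier fε t‖ ≤ c * |t|) (hh : 0 < h) (hν : Continuous ν) :
    Integrable fun t : ℝ => Complex.I * t * highPart K fε G h ν t := by
  have i1 := integrable_estimator hK hKsupp hfε hne hh hν
  have i2 := integrable_fourier_scaled_mul hK hKsupp hh ((continuous_fourier hG).mul hν)
  refine (i1.sub i2).congr (ae_of_all _ fun t => ?_)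
  simp only [Pi.sub_apply, Pi.mul_apply]
  rw [I_mul_mul_highPart hc hne]
  ring

theorem fourier_scaled_convolution (hK : Integrable K) (hG : Integrable G) (hh : 0 < h) (t : ℝ) :
    fourier (scaled K h ⋆ G) t = fourier (scaled K h) t * fourier G t :=
  fourier_convolution (integrable_scaled hK hh) hG t

/-- The primitive of an estimator splits into a low-frequency part, in which `1 / fourier fε` is
replaced by the Fourier transform of the integrable function `G`, and a high-frequency part. -/
theorem integral_estimator_eq (hK : Integrable K) (hKsupp : ∀ t : ℝ, 1 < |t| → fourier K t = 0)
    (hfε : Integrable fε) (hne : ∀ t, fourier fε t ≠ 0) (hG : Integrable G)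
    (hc : ∀ t, ‖1 - fourier G t * fourier fε t‖ ≤ c * |t|) (hh : 0 < h) (hν : Continuous ν)
    (x : ℝ) :
    ∫ u in (0 : ℝ)..x, fourierInv (fun t => fourier (scaled K h) t * ν t / fourier fε t) u
      = (∫ u in (0 : ℝ)..x, fourierInv (fun t => fourier (scaled K h ⋆ G) t * ν t) u)
        + ∫ u in (0 : ℝ)..x, fourierInv (fun t => Complex.I * t * highPart K fε G h ν t) u := by
  have i2 : Integrable fun t => fourier (scaled K h ⋆ G) t * ν t := by
    refine (integrable_fourier_scaled_mul hK hKsupp hh ((continuous_fourier hG).mul hν)).congr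
      (ae_of_all _ fun t => ?_)
    simp only [Pi.mul_apply]
    rw [fourier_scaled_convolution hK hG hh, mul_assoc]
  have e : ∀ t : ℝ, Complex.I * t * highPart K fε G h ν t
      = fourier (scaled K h) t * ν t / fourier fε t - fourier (scaled K h ⋆ G) t * ν t := by
    intro t
    rw [I_mul_mul_highPart hc hne, fourier_scaled_convolution hK hG hh]
  have i3 := integrable_I_mul_mul_highPart hK hKsupp hfε hne hG hc hh hν
  rw [← intervalIntegral.integral_add ((continuous_fourierInv i2).intervalIntegrable _ _)
    ((continuous_fourierInv i3).intervalIntegrable _ _)]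
  congr 1
  ext u
  rw [← fourierInv_add i2 i3]
  congr 1
  ext t
  rw [e]
  ring

theorem integrable_fourier_scaled_convolution (hK : Integrable K)
    (hKsupp : ∀ t : ℝ, 1 < |t| → fourier K t = 0) (hG : Integrable G) (hh : 0 < h) :
    Integrable (fourier (scaled K h ⋆ G)) := by
  refine (integrable_fourier_scaled_mul hK hKsupp hh (continuous_fourier hG)).congr
    (ae_of_all _ fun t => ?_)
  rw [fourier_scaled_convolution hK hG hh]

theorem ofReal_cdfEst (K fε : ℝ → ℝ) (h : ℝ) (n : ℕ) (y : ℕ → ℝ) (x : ℝ) :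
    (cdfEst K fε h n y x : ℂ) = ∫ u in (0 : ℝ)..x,
      fourierInv (fun t => fourier (scaled K h) t * empChar n y t / fourier fε t) u := by
  rw [cdfEst, ← intervalIntegral.integral_ofReal]
  congr 1
  ext u
  rw [← densityEstC_eq_ofReal, densityEstC]

theorem continuous_densityEst (hK : Integrable K) (hKsupp : ∀ t : ℝ, 1 < |t| → fourier K t = 0)
    (hfε : Integrable fε) (hne : ∀ t, fourier fε t ≠ 0) (hh : 0 < h) (n : ℕ) (y : ℕ → ℝ) :
    Continuous (densityEst K fε h n y) :=
  Complex.continuous_re.comp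
    (continuous_fourierInv (integrable_estimator hK hKsupp hfε hne hh (continuous_empChar n y)))

/-- For every sample the estimator of the distribution function has a limit: its low-frequency part is
an average of increments of the empirical distribution function, and its high-frequency part is
covered by the Riemann–Lebesgue lemma. -/
theorem exists_tendsto_cdfEst (hK : Integrable K) (hKsupp : ∀ t : ℝ, 1 < |t| → fourier K t = 0)
    (hfε : Integrable fε) (hne : ∀ t, fourier fε t ≠ 0) (hG : Integrable G) (hc0 : 0 ≤ c)
    (hc : ∀ t, ‖1 - fourier G t * fourier fε t‖ ≤ c * |t|) (hh : 0 < h) (n : ℕ) (y : ℕ → ℝ) :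
    ∃ L : ℝ, Tendsto (cdfEst K fε h n y) atTop (𝓝 L) := by
  have hν := continuous_empChar n y
  have hA : Integrable (scaled K h ⋆ G) := (integrable_scaled hK hh).integrable_convolution _ hG
  have hA' := integrable_fourier_scaled_convolution hK hKsupp hG hh
  have hH := integrable_highPart hK hKsupp hfε hne hG hc0 hc hh hν
  have hH' := integrable_I_mul_mul_highPart hK hKsupp hfε hne hG hc hh hν
  set H := highPart K fε G h (empChar n y)
  have hlim : Tendsto (fun x =>
      ((∫ z, (scaled K h ⋆ G) z * (empMeas n y).real (Ioc (-z) (x - z)) : ℝ) : ℂ)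
      + (fourierInv H 0 - fourierInv H x)) atTop
      (𝓝 (((∫ z, (scaled K h ⋆ G) z * (empMeas n y).real (Ioi (-z)) : ℝ) : ℂ)
        + (fourierInv H 0 - 0))) :=
    ((Complex.continuous_ofReal.tendsto _).comp (tendsto_integral_mul_real_Ioc hA _)).add
      (tendsto_const_nhds.sub (tendsto_fourierInv_atTop H))
  refine ⟨_, ((Complex.continuous_re.tendsto _).comp hlim).congr' ?_⟩
  filter_upwards [eventually_ge_atTop 0] with x hx
  rw [Function.comp_apply, ← integral_fourierInv_mul hH hH',
    ← integral_fourierInv_fourier_mul_charFun hA hA' _ hx]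
  simp only [charFun_empMeas]
  rw [← integral_estimator_eq hK hKsupp hfε hne hG hc hh hν, ← ofReal_cdfEst,
    Complex.ofReal_re]

theorem boundedOn_cdfEst {L : ℝ} {n : ℕ} {y : ℕ → ℝ}
    (hcont : Continuous (densityEst K fε h n y))
    (hL : Tendsto (cdfEst K fε h n y) atTop (𝓝 L)) : BoundedOn (cdfEst K fε h n y) (Ici 0) := by
  have hc : Continuous (cdfEst K fε h n y) :=
    intervalIntegral.continuous_primitive (fun a b => hcont.intervalIntegrable a b) 0
  obtain ⟨T, hT⟩ := (hL.eventually (Metric.ball_mem_nhds L one_pos)).exists_forall_of_atTop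
  obtain ⟨B, hB⟩ := (isCompact_Icc (a := (0 : ℝ)) (b := T)).exists_bound_of_continuousOn
    hc.continuousOn
  refine ⟨max B (|L| + 1), fun x hx => ?_⟩
  rcases le_total x T with h1 | h1
  · exact (hB x ⟨hx, h1⟩).trans (le_max_left _ _)
  · have h2 := hT x h1
    rw [Real.dist_eq] at h2
    have h3 := abs_sub_abs_le_abs_sub (cdfEst K fε h n y x) L
    exact le_trans (by linarith) (le_max_right _ _)

/-- The primitive of a difference of estimators is controlled by the uniform distance of the
distribution functions (low frequencies) and by an `L¹` norm (high frequencies). -/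
theorem norm_integral_estimator_sub_le (hK : Integrable K)
    (hKsupp : ∀ t : ℝ, 1 < |t| → fourier K t = 0)
    (hfε : Integrable fε) (hne : ∀ t, fourier fε t ≠ 0) (hG : Integrable G) (hc0 : 0 ≤ c)
    (hc : ∀ t, ‖1 - fourier G t * fourier fε t‖ ≤ c * |t|) (hh : 0 < h)
    (P Q : Measure ℝ) [IsFiniteMeasure P] [IsFiniteMeasure Q] {η : ℝ}
    (hη : ∀ s, |Q.real (Iic s) - P.real (Iic s)| ≤ η) {x : ℝ} (hx : 0 ≤ x) :
    ‖∫ u in (0 : ℝ)..x, fourierInv (fun t =>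
        fourier (scaled K h) t * (charFun Q t - charFun P t) / fourier fε t) u‖
      ≤ (∫ v, |K v|) * (∫ v, |G v|) * (2 * η)
        + c * ∫ t, ‖fourier (scaled K h) t * (charFun Q t - charFun P t) / fourier fε t‖ := by
  have hν : Continuous fun t => charFun Q t - charFun P t :=
    (continuous_charFun Q).sub (continuous_charFun P)
  have hA : Integrable (scaled K h ⋆ G) := (integrable_scaled hK hh).integrable_convolution _ hG
  have hA' := integrable_fourier_scaled_convolution hK hKsupp hG hh
  have hH := integrable_highPart hK hKsupp hfε hne hG hc0 hc hh hν
  have hH' := integrable_I_mul_mul_highPart hK hKsupp hfε hne hG hc hh hν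
  have hη0 : 0 ≤ η := (abs_nonneg _).trans (hη 0)
  rw [integral_estimator_eq hK hKsupp hfε hne hG hc hh hν]
  refine (norm_add_le _ _).trans (add_le_add ?_ ?_)
  · have iP : ∀ R : Measure ℝ, IsFiniteMeasure R →
        Integrable fun t => fourier (scaled K h ⋆ G) t * charFun R t := fun R _ =>
      hA'.mul_bdd (c := R.real univ) (continuous_charFun R).aestronglyMeasurable
        (ae_of_all _ fun t => norm_charFun_le t)
    have e : ∀ u, fourierInv (fun t => fourier (scaled K h ⋆ G) t * (charFun Q t - charFun P t)) u
        = fourierInv (fun t => fourier (scaled K h ⋆ G) t * charFun Q t) u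
          - fourierInv (fun t => fourier (scaled K h ⋆ G) t * charFun P t) u := by
      intro u
      rw [← fourierInv_sub (iP Q inferInstance) (iP P inferInstance)]
      congr 1
      ext t
      ring
    simp only [e]
    rw [intervalIntegral.integral_sub
      ((continuous_fourierInv (iP Q inferInstance)).intervalIntegrable _ _)
      ((continuous_fourierInv (iP P inferInstance)).intervalIntegrable _ _),
      integral_fourierInv_fourier_mul_charFun hA hA' Q hx,
      integral_fourierInv_fourier_mul_charFun hA hA' P hx, ← Complex.ofReal_sub,
      Complex.norm_real, ← integral_sub (integrable_mul_real_Ioc hA Q x)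
        (integrable_mul_real_Ioc hA P x)]
    have hIoc : ∀ (R : Measure ℝ) [IsFiniteMeasure R] (z : ℝ),
        R.real (Ioc (-z) (x - z)) = R.real (Iic (x - z)) - R.real (Iic (-z)) := by
      intro R _ z
      rw [← Iic_sdiff_Iic, measureReal_sdiff (Iic_subset_Iic.2 (by linarith)) measurableSet_Iic]
    refine (norm_integral_le_integral_norm _).trans ?_
    have hle : ∫ z, ‖(scaled K h ⋆ G) z * Q.real (Ioc (-z) (x - z))
        - (scaled K h ⋆ G) z * P.real (Ioc (-z) (x - z))‖
        ≤ ∫ z, |(scaled K h ⋆ G) z| * (2 * η) := by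
      refine integral_mono_of_nonneg (ae_of_all _ fun z => norm_nonneg _)
        (hA.abs.mul_const _) (ae_of_all _ fun z => ?_)
      simp only
      rw [← mul_sub, norm_mul, Real.norm_eq_abs, Real.norm_eq_abs]
      refine mul_le_mul_of_nonneg_left ?_ (abs_nonneg _)
      rw [hIoc Q, hIoc P]
      have h1 := abs_le.1 (hη (x - z))
      have h2 := abs_le.1 (hη (-z))
      exact abs_le.2 ⟨by linarith, by linarith⟩
    refine hle.trans ?_
    rw [integral_mul_const]
    refine mul_le_mul_of_nonneg_right ?_ (by linarith)
    rw [← integral_abs_scaled K hh]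
    exact integral_abs_convolution_le (integrable_scaled hK hh) hG
  · refine (norm_integral_fourierInv_mul_le hH hH' x).trans ?_
    rw [← integral_const_mul]
    exact integral_mono hH.norm
      ((integrable_estimator hK hKsupp hfε hne hh hν).norm.const_mul c)
      fun t => norm_highPart_le hc0 hc t

/-- The kernel confines the noise to frequencies up to `1 / h`, where `1 / fourier fε` is at most of
order `h ^ (-β)`. -/
theorem integral_norm_estimator_le
    (hKsupp : ∀ t : ℝ, 1 < |t| → fourier K t = 0) (hh : 0 < h) (hν : Continuous ν) {β C : ℝ}
    (hβ : 0 < β) (hC : 0 < C)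
    (hinv : ∀ t : ℝ, ‖1 / fourier fε t‖ ≤ C * (1 + |t| ^ 2) ^ (β / 2)) :
    ∫ t, ‖fourier (scaled K h) t * ν t / fourier fε t‖ ≤
      (∫ v, |K v|) * (C * (1 + h⁻¹ ^ 2) ^ (β / 2) * ∫ t in Icc (-h⁻¹) h⁻¹, ‖ν t‖) := by
  have e : ∀ t, ‖fourier (scaled K h) t * ν t / fourier fε t‖ ≤
      (Icc (-h⁻¹) h⁻¹).indicator
        (fun t => (∫ v, |K v|) * (C * (1 + h⁻¹ ^ 2) ^ (β / 2) * ‖ν t‖)) t := by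
    intro t
    by_cases ht : t ∈ Icc (-h⁻¹) h⁻¹
    · rw [indicator_of_mem ht, div_eq_mul_one_div, norm_mul, norm_mul, mul_assoc,
        mul_comm (‖ν t‖)]
      have h1 : ‖fourier (scaled K h) t‖ ≤ ∫ v, |K v| :=
        (norm_fourier_le _ t).trans_eq (integral_abs_scaled K hh)
      have h2 : C * (1 + |t| ^ 2) ^ (β / 2) ≤ C * (1 + h⁻¹ ^ 2) ^ (β / 2) := by
        have : |t| ≤ h⁻¹ := abs_le.2 ht
        gcongr
      exact mul_le_mul h1 (mul_le_mul_of_nonneg_right ((hinv t).trans h2) (norm_nonneg _))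
        (by positivity) (integral_nonneg fun v => abs_nonneg _)
    · rw [indicator_of_notMem ht, fourier_scaled_eq_zero hKsupp hh ht]
      simp
  have hint : Integrable ((Icc (-h⁻¹) h⁻¹).indicator
      (fun t => (∫ v, |K v|) * (C * (1 + h⁻¹ ^ 2) ^ (β / 2) * ‖ν t‖))) :=
    (integrable_indicator_iff measurableSet_Icc).2
      (Continuous.integrableOn_Icc (by fun_prop))
  refine (integral_mono_of_nonneg (ae_of_all _ fun t => norm_nonneg _) hint
    (ae_of_all _ e)).trans_eq ?_
  rw [integral_indicator measurableSet_Icc, integral_const_mul, integral_const_mul]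

/-- The bias of the primitive: smoothing a Lipschitz distribution function by `scaled K h` moves
its increments by little, uniformly. -/
theorem norm_integral_fourierInv_scaled_sub_le (hK : Integrable K) (hKone : ∫ x, K x = 1)
    (hKsupp : ∀ t : ℝ, 1 < |t| → fourier K t = 0) (hh : 0 < h)
    (P : Measure ℝ) [IsProbabilityMeasure P] {B : ℝ}
    (hB : ∀ a b, |P.real (Iic a) - P.real (Iic b)| ≤ B * |a - b|) {x : ℝ} (hx : 0 ≤ x) :
    ‖(∫ u in (0 : ℝ)..x, fourierInv (fun t => fourier (scaled K h) t * charFun P t) u)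
        - ((P.real (Iic x) - P.real (Iic 0) : ℝ) : ℂ)‖
      ≤ ∫ v, |K v| * (2 * min 1 (B * |h * v|)) := by
  have hS := integrable_scaled hK hh
  have hS' : Integrable (fourier (scaled K h)) := by
    have := integrable_fourier_scaled_mul hK hKsupp hh (ψ := fun _ => 1) continuous_const
    simpa using this
  have hIoc : ∀ z : ℝ, P.real (Ioc (-z) (x - z)) = P.real (Iic (x - z)) - P.real (Iic (-z)) := by
    intro z
    rw [← Iic_sdiff_Iic, measureReal_sdiff (Iic_subset_Iic.2 (by linarith)) measurableSet_Iic]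
  have hone : ∫ z, scaled K h z = 1 := by
    have := integral_scaled_mul K (fun _ => 1) hh
    simpa [hKone] using this
  rw [integral_fourierInv_fourier_mul_charFun hS hS' P hx, ← Complex.ofReal_sub,
    Complex.norm_real]
  have h1 : (P.real (Iic x) - P.real (Iic 0))
      = ∫ z, scaled K h z * (P.real (Iic x) - P.real (Iic 0)) := by
    rw [integral_mul_const, hone, one_mul]
  rw [h1, ← integral_sub (integrable_mul_real_Ioc hS P x) (hS.mul_const _)]
  simp only [← mul_sub]
  rw [integral_scaled_mul K
    (fun z => P.real (Ioc (-z) (x - z)) - (P.real (Iic x) - P.real (Iic 0))) hh]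
  refine (norm_integral_le_integral_norm _).trans ?_
  have hB0 : 0 ≤ B := by
    have := (abs_nonneg _).trans (hB 1 0)
    simpa using this
  have hdist : ∀ a b, |P.real (Iic a) - P.real (Iic b)| ≤ min 1 (B * |a - b|) := by
    intro a b
    refine le_min (abs_le.2 ⟨?_, ?_⟩) (hB a b) <;>
    linarith [measureReal_nonneg (μ := P) (s := Iic a), measureReal_nonneg (μ := P) (s := Iic b),
      measureReal_le_one (μ := P) (s := Iic a), measureReal_le_one (μ := P) (s := Iic b)]
  refine integral_mono_of_nonneg (ae_of_all _ fun v => norm_nonneg _) ?_ (ae_of_all _ fun v => ?_)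
  · refine hK.abs.mul_bdd (c := 2) (Measurable.aestronglyMeasurable (by fun_prop))
      (ae_of_all _ fun v => ?_)
    rw [Real.norm_eq_abs, abs_of_nonneg (by positivity)]
    linarith [min_le_left 1 (B * |h * v|)]
  · simp only
    rw [norm_mul, Real.norm_eq_abs, Real.norm_eq_abs, hIoc]
    refine mul_le_mul_of_nonneg_left ?_ (abs_nonneg _)
    have a1 := hdist (x - h * v) x
    have a2 := hdist (-(h * v)) 0
    rw [show x - h * v - x = -(h * v) by ring, abs_neg (h * v)] at a1
    rw [sub_zero, abs_neg (h * v)] at a2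
    rw [abs_le] at a1 a2 ⊢
    constructor <;> linarith

theorem tendsto_bias_cdf (hK : Integrable K) {B : ℝ} (hB : 0 ≤ B) {h : ℕ → ℝ}
    (hzero : Tendsto h atTop (𝓝 0)) :
    Tendsto (fun n => ∫ v, |K v| * (2 * min 1 (B * |h n * v|))) atTop (𝓝 0) := by
  have h0 : ∫ v, |K v| * (2 * min 1 (B * |(0 : ℝ) * v|)) = 0 := by simp
  rw [← h0]
  refine tendsto_integral_filter_of_dominated_convergence (fun v => |K v| * 2)
    (Eventually.of_forall fun n => hK.abs.aestronglyMeasurable.mul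
      (Measurable.aestronglyMeasurable (by fun_prop)))
    (Eventually.of_forall fun n => ae_of_all _ fun v => ?_) (hK.abs.mul_const 2)
    (ae_of_all _ fun v => ?_)
  · rw [Real.norm_eq_abs, abs_mul, abs_abs,
      abs_of_nonneg (by positivity : 0 ≤ 2 * min 1 (B * |h n * v|))]
    refine mul_le_mul_of_nonneg_left ?_ (abs_nonneg _)
    linarith [min_le_left 1 (B * |h n * v|)]
  · exact (((tendsto_const_nhds.min (((hzero.mul_const v).abs).const_mul B)).const_mul 2).const_mul _)

theorem tendsto_bias_density (hK : Integrable K) (hKone : ∫ x, K x = 1)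
    (hf : Integrable (fourier f)) {h : ℕ → ℝ} (hpos : ∀ n, 0 < h n)
    (hzero : Tendsto h atTop (𝓝 0)) :
    Tendsto (fun n => ∫ t, ‖fourier (scaled K (h n)) t * fourier f t - fourier f t‖) atTop
      (𝓝 0) := by
  have h0 : ∫ t : ℝ, ‖fourier K 0 * fourier f t - fourier f t‖ = 0 := by
    have : fourier K 0 = 1 := by
      simp only [fourier]
      simp [integral_complex_ofReal, hKone]
    simp [this]
  rw [← h0]
  have hb : ∀ n t, ‖fourier (scaled K (h n)) t‖ ≤ ∫ v, |K v| := fun n t =>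
    (norm_fourier_le _ t).trans_eq (integral_abs_scaled K (hpos n))
  refine tendsto_integral_filter_of_dominated_convergence
    (fun t => ((∫ v, |K v|) + 1) * ‖fourier f t‖)
    (Eventually.of_forall fun n => ?_)
    (Eventually.of_forall fun n => ae_of_all _ fun t => ?_) (hf.norm.const_mul _)
    (ae_of_all _ fun t => ?_)
  · exact (((continuous_fourier (integrable_scaled hK (hpos n))).aestronglyMeasurable.mul
      hf.aestronglyMeasurable).sub hf.aestronglyMeasurable).norm
  · rw [norm_norm, ← sub_one_mul, norm_mul]
    refine mul_le_mul_of_nonneg_right ((norm_sub_le _ _).trans ?_) (norm_nonneg _)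
    rw [norm_one]
    linarith [hb n t]
  · refine Tendsto.norm (Tendsto.sub_const (Tendsto.mul_const _ ?_) _)
    have h1 : Tendsto (fun n => h n * t) atTop (𝓝 0) := by
      have := hzero.mul_const t
      rwa [zero_mul] at this
    have h2 := ((continuous_fourier hK).tendsto 0).comp h1
    exact h2.congr fun n => (fourier_scaled K (hpos n) t).symm

end Estimator

/-! ### The measurement error model -/

section Density

variable {g f : ℝ → ℝ} {P : Measure ℝ}

theorem integrable_density [IsProbabilityMeasure P] (hg : Measurable g) (hg0 : ∀ x, 0 ≤ g x)
    (hP : P = volume.withDensity fun x => ENNReal.ofReal (g x)) :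
    Integrable g ∧ ∫ x, g x = 1 := by
  have h1 : ∫⁻ x, ENNReal.ofReal (g x) = 1 := by
    have := measure_univ (μ := P)
    rwa [hP, withDensity_apply _ MeasurableSet.univ, setLIntegral_univ] at this
  refine ⟨(lintegral_ofReal_ne_top_iff_integrable hg.aestronglyMeasurable (ae_of_all _ hg0)).1
    (by simp [h1]), ?_⟩
  rw [integral_eq_lintegral_of_nonneg_ae (ae_of_all _ hg0) hg.aestronglyMeasurable, h1]
  simp

theorem charFun_density (hg : Measurable g) (hg0 : ∀ x, 0 ≤ g x)
    (hP : P = volume.withDensity fun x => ENNReal.ofReal (g x)) (t : ℝ) :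
    charFun P t = fourier g t := by
  rw [charFun_apply_real, hP, integral_withDensity_eq_integral_toReal_smul (by fun_prop)
    (ae_of_all _ fun x => ENNReal.ofReal_lt_top), fourier]
  congr 1
  ext s
  rw [ENNReal.toReal_ofReal (hg0 s), Complex.real_smul, mul_comm]
  congr 2
  ring

variable [IsProbabilityMeasure P]

theorem real_Iic_sub_density (hg : Measurable g) (hg0 : ∀ x, 0 ≤ g x)
    (hP : P = volume.withDensity fun x => ENNReal.ofReal (g x)) {a b : ℝ} (hab : a ≤ b) :
    P.real (Iic b) - P.real (Iic a) = ∫ x in a..b, g x := by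
  rw [← measureReal_sdiff (Iic_subset_Iic.2 hab) measurableSet_Iic, Iic_sdiff_Iic,
    intervalIntegral.integral_of_le hab, Measure.real, hP, withDensity_apply _ measurableSet_Ioc,
    integral_eq_lintegral_of_nonneg_ae (ae_of_all _ hg0) hg.aestronglyMeasurable]

theorem abs_real_Iic_sub_le (hg : Measurable g) (hg0 : ∀ x, 0 ≤ g x)
    (hP : P = volume.withDensity fun x => ENNReal.ofReal (g x)) {B : ℝ} (hB : ∀ x, |g x| ≤ B)
    (a b : ℝ) : |P.real (Iic a) - P.real (Iic b)| ≤ B * |a - b| := by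
  wlog hab : b ≤ a generalizing a b
  · rw [abs_sub_comm, abs_sub_comm a]
    exact this b a (le_of_not_ge hab)
  rw [real_Iic_sub_density hg hg0 hP hab]
  exact intervalIntegral.norm_integral_le_of_norm_le_const (f := g) fun x _ => hB x

/-- The distribution function of a nonnegative variable whose density is continuous on `[0, ∞)`. -/
theorem boundedC1_cdf (hg : Measurable g) (hg0 : ∀ x, 0 ≤ g x)
    (hP : P = volume.withDensity fun x => ENNReal.ofReal (g x)) (hP0 : P (Iio 0) = 0)
    (hbdd : ∃ B : ℝ, ∀ x, |g x| ≤ B) (hcont : ContinuousOn g (Ici 0)) :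
    BoundedC1 (fun x => cdf P x) g ∧ cdf P 0 = 0 := by
  have h0 : P.real (Iic 0) = 0 := by
    have h1 : P {0} = 0 := by
      rw [hP]
      exact measure_singleton _
    rw [Measure.real, ← Iio_union_right, measure_union_null hP0 h1, ENNReal.toReal_zero]
  refine ⟨⟨⟨1, fun x _ => abs_le.2 ⟨?_, cdf_le_one P x⟩⟩, hbdd.imp fun B hB x _ => hB x, ?_⟩, ?_⟩
  · linarith [cdf_nonneg P x]
  · intro x hx
    -- on `[0, ∞)` the density may be replaced by a continuous function on the line
    have hc : Continuous fun x => g (max x 0) :=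
      hcont.comp_continuous (by fun_prop) fun x => mem_Ici.2 (le_max_right _ _)
    have h1 := (intervalIntegral.integral_hasDerivAt_right (hc.intervalIntegrable 0 x)
      (hc.stronglyMeasurableAtFilter _ _) hc.continuousAt).hasDerivWithinAt (s := Ici 0)
    rw [max_eq_left (mem_Ici.1 hx)] at h1
    have h2 : ∀ z ∈ Ici (0 : ℝ), cdf P z = ∫ u in (0 : ℝ)..z, g (max u 0) := by
      intro z hz
      have := real_Iic_sub_density hg hg0 hP (mem_Ici.1 hz)
      rw [h0, sub_zero] at this
      rw [cdf_eq_real, this]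
      refine intervalIntegral.integral_congr fun u hu => ?_
      rw [uIcc_of_le (mem_Ici.1 hz)] at hu
      rw [max_eq_left hu.1]
    exact h1.congr h2 (h2 x hx)
  · rw [cdf_eq_real, h0]

/-- Fourier inversion for a density that is continuous on `[0, ∞)`, at every point there. -/
theorem fourierInv_fourier_eqOn (hf : Integrable f) (hf' : Integrable (fourier f))
    (hcont : ContinuousOn f (Ici 0)) {x : ℝ} (hx : 0 ≤ x) :
    fourierInv (fourier f) x = f x := by
  have h1 : (fun x => fourierInv (fourier f) x) =ᵐ[volume.restrict (Ici 0)] fun x => (f x : ℂ) :=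
    ae_restrict_of_ae (fourierInv_fourier_ae hf hf')
  exact Measure.eqOn_of_ae_eq h1 (continuous_fourierInv hf').continuousOn
    (Complex.continuous_ofReal.comp_continuousOn hcont)
    (by rw [interior_Ici, closure_Ioi]) hx

end Density

section ModelFacts

variable {Ω : Type*} [MeasurableSpace Ω] {μ : Measure Ω}
  {X ε : ℕ → Ω → ℝ} {f fε : ℝ → ℝ}

theorem Model.iIndepFun_add (hm : Model μ X ε f fε) : iIndepFun (fun i ω => X i ω + ε i ω) μ :=
  hm.indep_pairs.comp (fun _ p => p.1 + p.2) fun _ => by fun_prop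

theorem Model.measurable_add (hm : Model μ X ε f fε) (i : ℕ) :
    Measurable fun ω => X i ω + ε i ω :=
  (hm.measurable_X i).add (hm.measurable_err i)

variable [IsProbabilityMeasure μ]

theorem Model.map_add (hm : Model μ X ε f fε) (i : ℕ) :
    μ.map (fun ω => X i ω + ε i ω) = μ.map fun ω => X 0 ω + ε 0 ω := by
  have h : ∀ j, μ.map (fun ω => X j ω + ε j ω)
      = (volume.withDensity fun x => ENNReal.ofReal (f x)).conv
        (volume.withDensity fun x => ENNReal.ofReal (fε x)) := fun j => by
    rw [← hm.law_X j, ← hm.law_err j]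
    exact (hm.indep_X_err j).map_add_eq_map_conv_map (hm.measurable_X j) (hm.measurable_err j)
  rw [h, h]

/-- The observations have no atoms, because the errors have none. -/
theorem Model.map_add_singleton (hm : Model μ X ε f fε) (x : ℝ) :
    μ.map (fun ω => X 0 ω + ε 0 ω) {x} = 0 := by
  have h1 := (hm.indep_X_err 0).map_add_eq_map_conv_map (hm.measurable_X 0) (hm.measurable_err 0)
  have h2 : SFinite (μ.map (ε 0)) := inferInstance
  have h3 : ∀ z, μ.map (ε 0) {z} = 0 := fun z => by
    rw [hm.law_err 0]
    exact measure_singleton z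
  change μ.map (X 0 + ε 0) {x} = 0
  rw [h1, Measure.conv, Measure.map_apply (by fun_prop) (measurableSet_singleton x),
    Measure.prod_apply ((by fun_prop : Measurable fun p : ℝ × ℝ => p.1 + p.2)
      (measurableSet_singleton x))]
  have h4 : ∀ u : ℝ, Prod.mk u ⁻¹' ((fun p : ℝ × ℝ => p.1 + p.2) ⁻¹' {x}) = {x - u} := by
    intro u
    ext v
    simp only [mem_preimage, mem_singleton_iff]
    constructor <;> intro h <;> linarith
  simp only [h4, h3, lintegral_zero]

theorem Model.charFun_add (hm : Model μ X ε f fε) (t : ℝ) :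
    charFun (μ.map fun ω => X 0 ω + ε 0 ω) t = fourier f t * fourier fε t := by
  have := Measure.isProbabilityMeasure_map (hm.measurable_X 0).aemeasurable (μ := μ)
  have := Measure.isProbabilityMeasure_map (hm.measurable_err 0).aemeasurable (μ := μ)
  rw [(hm.indep_X_err 0).charFun_map_fun_add_eq_mul (hm.measurable_X 0).aemeasurable
    (hm.measurable_err 0).aemeasurable, Pi.mul_apply,
    charFun_density hm.measurable_f hm.f_nonneg (hm.law_X 0),
    charFun_density hm.measurable_f_err hm.f_err_nonneg (hm.law_err 0)]

/-- The bandwidth condition makes the amplified noise negligible: it is of order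
`h ^ (-β) * h⁻¹ / √n = (h ^ (2 + 2 * β) * n) ^ (-1 / 2)`. -/
theorem tendsto_noise {h : ℕ → ℝ} (hpos : ∀ n, 0 < h n) (hzero : Tendsto h atTop (𝓝 0))
    {β : ℝ} (C : ℝ) (hβ : 0 < β) (hC : 0 < C)
    (hrate : Tendsto (fun n : ℕ => h n ^ (2 + 2 * β) * (n : ℝ)) atTop atTop) :
    Tendsto (fun n : ℕ => C * (1 + (h n)⁻¹ ^ 2) ^ (β / 2) * (4 * (h n)⁻¹ / √n)) atTop (𝓝 0) := by
  have h1 : Tendsto (fun n : ℕ => 4 * C * 2 ^ (β / 2) * (√(h n ^ (2 + 2 * β) * (n : ℝ)))⁻¹) atTop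
      (𝓝 0) := by
    have := ((tendsto_inv_atTop_zero.comp (Real.tendsto_sqrt_atTop.comp hrate)).const_mul
      (4 * C * 2 ^ (β / 2)))
    rwa [mul_zero] at this
  refine squeeze_zero' (Eventually.of_forall fun n => ?_) ?_ h1
  · have := hpos n
    positivity
  filter_upwards [hzero.eventually (Iic_mem_nhds one_pos)] with n hn
  have hh := hpos n
  have hn1 : h n ≤ 1 := hn
  have e1 : (1 + (h n)⁻¹ ^ 2) ^ (β / 2) ≤ 2 ^ (β / 2) * (h n) ^ (-β) := by
    have h2 : 1 + (h n)⁻¹ ^ 2 ≤ 2 * (h n)⁻¹ ^ 2 := by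
      have : 1 ≤ (h n)⁻¹ := (one_le_inv₀ hh).2 hn1
      nlinarith
    calc (1 + (h n)⁻¹ ^ 2) ^ (β / 2) ≤ (2 * (h n)⁻¹ ^ 2) ^ (β / 2) := by gcongr
      _ = 2 ^ (β / 2) * (h n) ^ (-β) := by
        rw [Real.mul_rpow (by norm_num) (by positivity), ← Real.rpow_natCast, ← Real.rpow_mul
          (by positivity), Real.inv_rpow hh.le, ← Real.rpow_neg hh.le]
        congr 2
        push_cast
        ring
  have e2 : √(h n ^ (2 + 2 * β) * (n : ℝ)) = h n ^ (1 + β) * √n := by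
    rw [Real.sqrt_mul (by positivity), Real.sqrt_eq_rpow, ← Real.rpow_mul hh.le]
    congr 2
    ring
  have e3 : (h n) ^ (-β) * (h n)⁻¹ = (h n ^ (1 + β))⁻¹ := by
    rw [← Real.rpow_neg_one (h n), ← Real.rpow_add hh, ← Real.rpow_neg hh.le]
    congr 1
    ring
  calc C * (1 + (h n)⁻¹ ^ 2) ^ (β / 2) * (4 * (h n)⁻¹ / √n)
      ≤ C * (2 ^ (β / 2) * (h n) ^ (-β)) * (4 * (h n)⁻¹ / √n) := by gcongr
    _ = 4 * C * 2 ^ (β / 2) * (((h n) ^ (-β) * (h n)⁻¹) * (√n)⁻¹) := by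
      rw [div_eq_mul_inv]
      ring
    _ = 4 * C * 2 ^ (β / 2) * (√(h n ^ (2 + 2 * β) * (n : ℝ)))⁻¹ := by
      rw [e2, e3, mul_inv]

/-- Uniform consistency, in probability, of the density estimator and of its primitive. The random
errors enter only through the uniform distance of the empirical distribution function of the
observations from the true one, and through the amplified noise of the characteristic function. -/
theorem tendsto_measure_estimator_dev (hm : Model μ X ε f fε)
    {K : ℝ → ℝ} (hK : Integrable K) (hKone : ∫ x, K x = 1)
    (hKsupp : ∀ t : ℝ, 1 < |t| → fourier K t = 0)
    {h : ℕ → ℝ} (hpos : ∀ n, 0 < h n) (hzero : Tendsto h atTop (𝓝 0))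
    {β C : ℝ} (hβ : 0 < β) (hC : 0 < C) (hne : ∀ t : ℝ, fourier fε t ≠ 0)
    (hinv : ∀ t : ℝ, ‖1 / fourier fε t‖ ≤ C * (1 + |t| ^ 2) ^ (β / 2))
    (hrate : Tendsto (fun n : ℕ => h n ^ (2 + 2 * β) * (n : ℝ)) atTop atTop)
    {B : ℝ} (hB : ∀ x, |f x| ≤ B) (hfcont : ContinuousOn f (Ici 0))
    (hfint : Integrable (fourier f)) {G : ℝ → ℝ} (hG : Integrable G) {c : ℝ} (hc0 : 0 ≤ c)
    (hc : ∀ t, ‖1 - fourier G t * fourier fε t‖ ≤ c * |t|)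
    (hF0 : cdf (μ.map (X 0)) 0 = 0) {η : ℝ} (hη : 0 < η) :
    Tendsto (fun n => μ {ω | ¬ ∀ x ∈ Ici (0 : ℝ),
      |densityEst K fε (h n) n (fun i => X i ω + ε i ω) x - f x| ≤ η ∧
      |cdfEst K fε (h n) n (fun i => X i ω + ε i ω) x - cdf (μ.map (X 0)) x| ≤ η})
      atTop (𝓝 0) := by
  have hprobX := Measure.isProbabilityMeasure_map (hm.measurable_X 0).aemeasurable (μ := μ)
  have hprobε := Measure.isProbabilityMeasure_map (hm.measurable_err 0).aemeasurable (μ := μ)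
  have hprobY := Measure.isProbabilityMeasure_map (hm.measurable_add 0).aemeasurable (μ := μ)
  have hφY := hm.charFun_add
  set PX := μ.map (X 0) with hPX
  set PY := μ.map fun ω => X 0 ω + ε 0 ω with hPY
  have hlawX : PX = volume.withDensity fun x => ENNReal.ofReal (f x) := hm.law_X 0
  have hf := (integrable_density hm.measurable_f hm.f_nonneg hlawX).1
  have hfε := (integrable_density hm.measurable_f_err hm.f_err_nonneg (hm.law_err 0)).1
  have hφX := charFun_density hm.measurable_f hm.f_nonneg hlawX
  have hB0 : 0 ≤ B := (abs_nonneg _).trans (hB 0)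
  set κ := ∫ v, |K v| with hκ
  have hκ0 : 0 ≤ κ := integral_nonneg fun v => abs_nonneg _
  set γ := ∫ v, |G v| with hγ
  have hγ0 : 0 ≤ γ := integral_nonneg fun v => abs_nonneg _
  set s : ℕ → ℝ := fun n => C * (1 + (h n)⁻¹ ^ 2) ^ (β / 2) with hs
  have hs0 : ∀ n, 0 ≤ s n := fun n => by positivity
  set J : ℕ → Ω → ℝ := fun n ω => ∫ t in Icc (-(h n)⁻¹) (h n)⁻¹,
    ‖empChar n (fun i => X i ω + ε i ω) t - charFun PY t‖ with hJ
  -- the tolerance for the two random quantities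
  set η' := η / 2 / (κ + 2 * κ * γ + c * κ + 1) with hη'
  have hden : 0 < κ + 2 * κ * γ + c * κ + 1 := by positivity
  have hη'0 : 0 < η' := by positivity
  have hη'1 : (κ + 2 * κ * γ + c * κ + 1) * η' = η / 2 := by
    rw [hη']
    field_simp
  have hGC := tendsto_measure_empMeas_Iic hm.measurable_add hm.iIndepFun_add hm.map_add
    hm.map_add_singleton hη'0
  have hnoise : Tendsto (fun n => μ {ω | η' ≤ s n * J n ω}) atTop (𝓝 0) := by
    refine tendsto_measure_ge_of_integral_le ?_ (tendsto_noise hpos hzero C hβ hC hrate) hη'0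
    filter_upwards [eventually_gt_atTop 0] with n hn
    have h1 := integral_integral_norm_empChar_sub_le hm.measurable_add hm.iIndepFun_add hm.map_add
      hn (inv_pos.2 (hpos n)).le
    refine ⟨fun ω => mul_nonneg (hs0 n) (integral_nonneg fun t => norm_nonneg _),
      h1.1.const_mul _, ?_⟩
    rw [integral_const_mul]
    exact mul_le_mul_of_nonneg_left h1.2 (hs0 n)
  have hsum := hGC.add hnoise
  rw [add_zero] at hsum
  have hbias1 := (tendsto_bias_density hK hKone hfint hpos hzero).eventually
    (Iic_mem_nhds (half_pos hη))
  have hbias2 := (tendsto_bias_cdf hK hB0 hzero).eventually (Iic_mem_nhds (half_pos hη))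
  refine tendsto_of_tendsto_of_tendsto_of_le_of_le' tendsto_const_nhds hsum
    (Eventually.of_forall fun n => zero_le) ?_
  filter_upwards [hbias1, hbias2] with n hb1 hb2
  refine (measure_mono fun ω hω => ?_).trans (measure_union_le _ _)
  by_contra hcon
  simp only [mem_union, mem_ofPred_eq, not_or, not_not, not_le] at hcon
  obtain ⟨hGCω, hJω⟩ := hcon
  refine hω fun x hx => ?_
  have hh := hpos n
  set y : ℕ → ℝ := fun i => X i ω + ε i ω with hy
  set k := fourier (scaled K (h n)) with hk
  have hν : Continuous fun t => empChar n y t - charFun PY t :=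
    (continuous_empChar n y).sub (continuous_charFun PY)
  have hint := integrable_estimator hK hKsupp hfε hne hh hν
  have hint2 : Integrable fun t => k t * fourier f t :=
    integrable_fourier_scaled_mul hK hKsupp hh (continuous_fourier hf)
  have hnorm : ∫ t, ‖k t * (empChar n y t - charFun PY t) / fourier fε t‖ ≤ κ * η' :=
    (integral_norm_estimator_le hKsupp hh hν hβ hC hinv).trans
      (mul_le_mul_of_nonneg_left hJω.le hκ0)
  -- the estimator is its stochastic error plus the smoothed density
  have hsplit : ∀ t, k t * empChar n y t / fourier fε t
      = k t * (empChar n y t - charFun PY t) / fourier fε t + k t * fourier f t := by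
    intro t
    rw [hφY]
    have := hne t
    field_simp
    ring
  have hpi : (2 * Real.pi)⁻¹ ≤ 1 := by
    refine inv_le_one_of_one_le₀ ?_
    linarith [Real.pi_gt_three]
  constructor
  · have e1 : ((densityEst K fε (h n) n y x - f x : ℝ) : ℂ)
        = fourierInv (fun t => k t * (empChar n y t - charFun PY t) / fourier fε t) x
          + fourierInv (fun t => k t * fourier f t - fourier f t) x := by
      push_cast
      rw [← densityEstC_eq_ofReal, densityEstC, fourierInv_sub hint2 hfint,
        fourierInv_fourier_eqOn hf hfint hfcont hx]
      simp only [← hk, hsplit]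
      rw [fourierInv_add hint hint2]
      ring
    rw [← Real.norm_eq_abs, ← Complex.norm_real, e1]
    refine (norm_add_le _ _).trans ?_
    have h1 := norm_fourierInv_le
      (fun t => k t * (empChar n y t - charFun PY t) / fourier fε t) x
    have h2 := norm_fourierInv_le (fun t => k t * fourier f t - fourier f t) x
    have h3 : ∫ t, ‖k t * fourier f t - fourier f t‖ ≤ η / 2 := hb1
    have h4 : 0 ≤ ∫ t, ‖k t * fourier f t - fourier f t‖ := integral_nonneg fun t => norm_nonneg _
    have h5 : 0 ≤ ∫ t, ‖k t * (empChar n y t - charFun PY t) / fourier fε t‖ :=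
      integral_nonneg fun t => norm_nonneg _
    have h6 : κ * η' ≤ η / 2 := by
      rw [← hη'1]
      gcongr
      have : 0 ≤ 2 * κ * γ + c * κ + 1 := by positivity
      linarith
    have h7 := mul_le_of_le_one_left h4 hpi
    have h8 := mul_le_of_le_one_left h5 hpi
    linarith
  · have e1 : ((cdfEst K fε (h n) n y x - cdf PX x : ℝ) : ℂ)
        = (∫ u in (0 : ℝ)..x, fourierInv
            (fun t => k t * (empChar n y t - charFun PY t) / fourier fε t) u)
          + ((∫ u in (0 : ℝ)..x, fourierInv (fun t => k t * charFun PX t) u)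
            - ((PX.real (Iic x) - PX.real (Iic 0) : ℝ) : ℂ)) := by
      rw [← cdf_eq_real, ← cdf_eq_real, hF0, sub_zero]
      push_cast
      rw [ofReal_cdfEst, ← add_sub_assoc]
      simp only [← hk, hsplit, hφX]
      congr 1
      rw [← intervalIntegral.integral_add ((continuous_fourierInv hint).intervalIntegrable _ _)
        ((continuous_fourierInv hint2).intervalIntegrable _ _)]
      congr 1
      ext u
      exact fourierInv_add hint hint2 u
    rw [← Real.norm_eq_abs, ← Complex.norm_real, e1]
    refine (norm_add_le _ _).trans ?_
    have h1 := norm_integral_estimator_sub_le hK hKsupp hfε hne hG hc0 hc hh PY (empMeas n y)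
      hGCω (mem_Ici.1 hx)
    simp only [charFun_empMeas] at h1
    have h2 := norm_integral_fourierInv_scaled_sub_le hK hKone hKsupp hh PX
      (abs_real_Iic_sub_le hm.measurable_f hm.f_nonneg hlawX hB) (mem_Ici.1 hx)
    have h3 : ∫ v, |K v| * (2 * min 1 (B * |h n * v|)) ≤ η / 2 := hb2
    have h4 := mul_le_mul_of_nonneg_left hnorm hc0
    have h5 : κ * γ * (2 * η') + c * (κ * η') ≤ η / 2 := by
      rw [← hη'1]
      have : 0 ≤ (κ + 1) * η' := by positivity
      linarith
    linarith

end ModelFacts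

/-! ### Consistency -/

section Consistency

variable {Ω : Type*} [MeasurableSpace Ω] {μ : Measure Ω}

theorem littleOP_supNorm {θ : ℕ → Ω → ℝ → ℝ}
    (h : ∀ δ : ℝ, 0 < δ →
      Tendsto (fun n => μ {ω | ¬ ∀ x ∈ Ici (0 : ℝ), |θ n ω x| ≤ δ}) atTop (𝓝 0)) :
    LittleOP μ fun n ω => supNorm (θ n ω) := by
  intro δ hδ
  obtain ⟨r, hr0, hr⟩ := ENNReal.lt_iff_exists_nnreal_btwn.1 hδ
  have hr0' : (0 : ℝ) < r := by exact_mod_cast hr0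
  refine tendsto_of_tendsto_of_tendsto_of_le_of_le tendsto_const_nhds (h r hr0')
    (fun n => zero_le) fun n => measure_mono fun ω hω hcon => ?_
  have h1 : supNorm (θ n ω) ≤ r := iSup₂_le fun x hx => by
    rw [← ENNReal.ofReal_coe_nnreal]
    exact ENNReal.ofReal_le_ofReal (hcon x hx)
  exact absurd (le_trans hω h1) (not_le.2 hr)

/-- Dividing by a number close to `1` preserves uniform closeness. -/
theorem abs_div_sub_le {a b B L η : ℝ} (hb : |b| ≤ B) (hab : |a - b| ≤ η) (hL : |L - 1| ≤ η)
    (hη : η ≤ 1 / 2) : |a / L - b| ≤ 2 * (1 + B) * η := by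
  have hL' := abs_le.1 hL
  have hL0 : 1 / 2 ≤ L := by linarith
  have hLpos : 0 < L := by linarith
  have h1 : a / L - b = ((a - b) - b * (L - 1)) / L := by
    field_simp
    ring
  rw [h1, abs_div, abs_of_pos hLpos, div_le_iff₀ hLpos]
  have h2 : |b * (L - 1)| ≤ B * η := by
    rw [abs_mul]
    exact mul_le_mul hb hL (abs_nonneg _) ((abs_nonneg _).trans hb)
  have h3 := abs_sub (a - b) (b * (L - 1))
  have h4 : 0 ≤ (1 + B) * η :=
    mul_nonneg (by linarith [(abs_nonneg b).trans hb]) ((abs_nonneg _).trans hab)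
  nlinarith

theorem BoundedC1.div_const {θ g : ℝ → ℝ} (h : BoundedC1 θ g) (L : ℝ) :
    BoundedC1 (fun x => θ x / L) fun x => g x / L := by
  obtain ⟨A, hA⟩ := h.bounded
  obtain ⟨B, hB⟩ := h.bounded_deriv
  refine ⟨⟨A / |L|, fun x hx => ?_⟩, ⟨B / |L|, fun x hx => ?_⟩,
    fun x hx => (h.hasDeriv x hx).div_const L⟩
  · rw [abs_div]
    exact div_le_div_of_nonneg_right (hA x hx) (abs_nonneg L)
  · rw [abs_div]
    exact div_le_div_of_nonneg_right (hB x hx) (abs_nonneg L)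

end Consistency

end Deconv

theorem mainTheorem7 {Ω : Type*} [MeasurableSpace Ω] (μ : Measure Ω) [IsProbabilityMeasure μ]
    (X ε : ℕ → Ω → ℝ) (f fε : ℝ → ℝ) (hmodel : Deconv.Model μ X ε f fε)
    -- the kernel and the bandwidths
    (K : ℝ → ℝ) (hKint : Integrable K) (hKone : ∫ x, K x = 1)
    (hKsupp : ∀ t : ℝ, 1 < |t| → Deconv.fourier K t = 0)
    (h : ℕ → ℝ) (hpos : ∀ n, 0 < h n) (hzero : Tendsto h atTop (𝓝 0))
    -- the error
    (β C : ℝ) (hβ : 0 < β) (hC : 0 < C)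
    (hne : ∀ t : ℝ, Deconv.fourier fε t ≠ 0)
    (hinv : ∀ t : ℝ, ‖1 / Deconv.fourier fε t‖ ≤ C * (1 + |t| ^ 2) ^ (β / 2))
    (hrate : Tendsto (fun n : ℕ => h n ^ (2 + 2 * β) * (n : ℝ)) atTop atTop)
    -- the density of interest
    (hfbdd : ∃ B : ℝ, ∀ x, |f x| ≤ B) (hfcont : ContinuousOn f (Ici 0))
    (hfint : Integrable (Deconv.fourier f)) :
    let F : ℝ → ℝ := fun x => cdf (μ.map (X 0)) x
    let Fd : ℕ → Ω → ℝ → ℝ := fun n ω => Deconv.cdfEst K fε (h n) n (fun i => X i ω + ε i ω)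
    let Fhat : ℕ → Ω → ℝ → ℝ :=
      fun n ω => Deconv.cdfEstNorm K fε (h n) n (fun i => X i ω + ε i ω)
    -- all the objects are well defined, with probability tending to one for the random ones
    DifferentiableOn ℝ (Deconv.lcMajorant F) (Ici 0) ∧
    Deconv.ProbTendsToOne μ (fun n ω =>
      Deconv.BoundedOn (Fd n ω) (Ici 0) ∧
      (∃ L : ℝ, 0 < L ∧ Tendsto (Fd n ω) atTop (𝓝 L)) ∧
      DifferentiableOn ℝ (Deconv.lcMajorant (Fd n ω)) (Ici 0) ∧
      DifferentiableOn ℝ (Deconv.lcMajorant (Fhat n ω)) (Ici 0)) ∧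
    -- consistency of the two concave estimators and of their slopes
    ∀ G : ℕ → Ω → ℝ → ℝ, G = Fd ∨ G = Fhat →
      Deconv.LittleOP μ (fun n ω => Deconv.supNorm (fun x =>
        Deconv.lcMajorant (G n ω) x - Deconv.lcMajorant F x)) ∧
      Deconv.LittleOP μ (fun n ω => Deconv.supNorm (fun x =>
        Deconv.slopeFn (Deconv.lcMajorant (G n ω)) x -
          Deconv.slopeFn (Deconv.lcMajorant F) x)) := by
  intro F Fd Fhat
  have hprobX := Measure.isProbabilityMeasure_map (hmodel.measurable_X 0).aemeasurable (μ := μ)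
  have hprobε := Measure.isProbabilityMeasure_map (hmodel.measurable_err 0).aemeasurable (μ := μ)
  obtain ⟨hfε, hfε1⟩ := Deconv.integrable_density hmodel.measurable_f_err hmodel.f_err_nonneg
    (hmodel.law_err 0)
  obtain ⟨G, hG, c, hc0, hc⟩ := Deconv.exists_norm_one_sub_fourier_mul_le hfε hmodel.f_err_nonneg
    hfε1
  have hX0 : μ.map (X 0) (Iio 0) = 0 := by
    rw [Measure.map_apply (hmodel.measurable_X 0) measurableSet_Iio]
    refine measure_mono_null (fun ω hω => ?_) (ae_iff.1 (hmodel.X_nonneg 0))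
    exact not_le.2 hω
  obtain ⟨hF, hF0⟩ : Deconv.BoundedC1 F f ∧ F 0 = 0 := Deconv.boundedC1_cdf hmodel.measurable_f
    hmodel.f_nonneg (hmodel.law_X 0) hX0 hfbdd hfcont
  obtain ⟨B, hB⟩ := hfbdd
  have hB0 : 0 ≤ B := (abs_nonneg _).trans (hB 0)
  have hF1 : ∀ x, |F x| ≤ 1 := fun x =>
    abs_le.2 ⟨by linarith [cdf_nonneg (μ.map (X 0)) x], cdf_le_one _ x⟩
  set fd : ℕ → Ω → ℝ → ℝ := fun n ω =>
    Deconv.densityEst K fε (h n) n (fun i => X i ω + ε i ω) with hfd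
  have hlimL : ∀ n ω, ∃ L : ℝ, Tendsto (Fd n ω) atTop (𝓝 L) := fun n ω =>
    Deconv.exists_tendsto_cdfEst hKint hKsupp hfε hne hG hc0 hc (hpos n) n _
  choose L hL using hlimL
  -- the limit exists, so `limUnder` is its value and not a default
  have hFhat : ∀ n ω, Fhat n ω = fun x => Fd n ω x / L n ω := by
    intro n ω
    ext x
    change Fd n ω x / limUnder atTop (Fd n ω) = _
    rw [(hL n ω).limUnder_eq]
  have hcont : ∀ n ω, Continuous (fd n ω) := fun n ω =>
    Deconv.continuous_densityEst hKint hKsupp hfε hne (hpos n) n _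
  have hC1 : ∀ n ω, Deconv.BoundedC1 (Fd n ω) (fd n ω) := by
    intro n ω
    refine ⟨Deconv.boundedOn_cdfEst (hcont n ω) (hL n ω), ?_, fun x _ => ?_⟩
    · refine ⟨(2 * Real.pi)⁻¹ * _, fun x _ => (Complex.abs_re_le_norm _).trans
        (Deconv.norm_fourierInv_le _ x)⟩
    · exact (intervalIntegral.integral_hasDerivAt_right ((hcont n ω).intervalIntegrable 0 x)
        ((hcont n ω).stronglyMeasurableAtFilter _ _) (hcont n ω).continuousAt).hasDerivWithinAt
  have hFd0 : ∀ n ω, Fd n ω 0 = 0 := fun n ω => intervalIntegral.integral_same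
  -- the event of uniform closeness
  set E : ℝ → ℕ → Ω → Prop := fun η n ω =>
    ∀ x ∈ Ici (0 : ℝ), |fd n ω x - f x| ≤ η ∧ |Fd n ω x - F x| ≤ η with hE
  have hEprob : ∀ η, 0 < η → Tendsto (fun n => μ {ω | ¬ E η n ω}) atTop (𝓝 0) := fun η hη =>
    Deconv.tendsto_measure_estimator_dev hmodel hKint hKone hKsupp hpos hzero hβ hC hne hinv hrate
      hB hfcont hfint hG hc0 hc hF0 hη
  have hEL : ∀ η n ω, E η n ω → |L n ω - 1| ≤ η := by
    intro η n ω hω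
    have h1 : Tendsto (fun x => |Fd n ω x - F x|) atTop (𝓝 |L n ω - 1|) :=
      ((hL n ω).sub (tendsto_cdf_atTop (μ.map (X 0)))).abs
    refine le_of_tendsto h1 ?_
    filter_upwards [eventually_ge_atTop 0] with x hx using (hω x hx).2
  have hdiff : ∀ n ω, DifferentiableOn ℝ (Deconv.lcMajorant (Fhat n ω)) (Ici 0) := fun n ω => by
    rw [hFhat]
    exact ((hC1 n ω).div_const _).differentiableOn
  refine ⟨hF.differentiableOn, ?_, ?_⟩
  · refine tendsto_of_tendsto_of_tendsto_of_le_of_le tendsto_const_nhds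
      (hEprob (1 / 2) (by norm_num)) (fun n => zero_le) fun n => measure_mono fun ω hω hcon => hω ?_
    refine ⟨(hC1 n ω).bounded, ⟨L n ω, ?_, hL n ω⟩, (hC1 n ω).differentiableOn, hdiff n ω⟩
    have := (abs_le.1 (hEL _ n ω hcon)).1
    linarith
  intro G' hG'
  have key : ∀ δ : ℝ, 0 < δ → ∃ η > 0, ∀ n ω, E η n ω → ∀ x ∈ Ici (0 : ℝ),
      |Deconv.lcMajorant (G' n ω) x - Deconv.lcMajorant F x| ≤ δ ∧
      |Deconv.slopeFn (Deconv.lcMajorant (G' n ω)) x -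
        Deconv.slopeFn (Deconv.lcMajorant F) x| ≤ δ := by
    intro δ hδ
    obtain ⟨η, hη, hstab⟩ := hF.exists_stability hδ
    rcases hG' with rfl | rfl
    · exact ⟨η, hη, fun n ω hω => hstab _ _ (hC1 n ω) ((hFd0 n ω).trans hF0.symm)
        (fun z hz => (hω z hz).2) fun z hz => (hω z hz).1⟩
    · -- normalizing costs a factor `4` for the functions, bounded by `1`, and `2 * (1 + B)` for their
      -- derivatives, bounded by `B`; `4 * (1 + B)` dominates both
      refine ⟨min (1 / 2) (η / (4 * (1 + B))), lt_min (by norm_num) (by positivity), ?_⟩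
      intro n ω hω
      set η' := min (1 / 2) (η / (4 * (1 + B)))
      have h1 : η' ≤ 1 / 2 := min_le_left _ _
      have h2 : η' * (4 * (1 + B)) ≤ η := by
        rw [← le_div_iff₀ (by positivity)]
        exact min_le_right _ _
      have h3 : 0 ≤ η' := (abs_nonneg _).trans (hEL _ n ω hω)
      have h4 : 0 ≤ B * η' := mul_nonneg hB0 h3
      rw [hFhat]
      refine hstab _ _ ((hC1 n ω).div_const (L n ω)) (by rw [hFd0, hF0, zero_div])
        (fun z hz => ?_) fun z hz => ?_
      · refine (Deconv.abs_div_sub_le (hF1 z) (hω z hz).2 (hEL _ n ω hω) h1).trans ?_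
        linarith
      · refine (Deconv.abs_div_sub_le (hB z) (hω z hz).1 (hEL _ n ω hω) h1).trans ?_
        linarith
  have key2 : ∀ δ : ℝ, 0 < δ → Tendsto (fun n => μ {ω | ¬ ∀ x ∈ Ici (0 : ℝ),
      |Deconv.lcMajorant (G' n ω) x - Deconv.lcMajorant F x| ≤ δ ∧
      |Deconv.slopeFn (Deconv.lcMajorant (G' n ω)) x -
        Deconv.slopeFn (Deconv.lcMajorant F) x| ≤ δ}) atTop (𝓝 0) := by
    intro δ hδ
    obtain ⟨η, hη, hkey⟩ := key δ hδ
    exact tendsto_of_tendsto_of_tendsto_of_le_of_le tendsto_const_nhds (hEprob η hη)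
      (fun n => zero_le) fun n => measure_mono fun ω hω hcon => hω (hkey n ω hcon)
  constructor <;> refine Deconv.littleOP_supNorm fun δ hδ =>
    tendsto_of_tendsto_of_tendsto_of_le_of_le tendsto_const_nhds (key2 δ hδ)
      (fun n => zero_le) fun n => measure_mono fun ω hω hcon => hω fun x hx => ?_
  · exact (hcon x hx).1
  · exact (hcon x hx).2
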